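/- Let $k$ be an algebraically closed field of characteristic $0$. Let $1\le a\le b$ be integers such that $a$ and $b$ both divide $d:=1+1+a+b$ (that is, $(a,b)\in\{(1,1),(1,3),(2,2),(2,4),(4,6)\}$), put $(a_0,a_1,a_2,a_3)=(1,1,a,b)$ and $h_i=d/a_i$. Let $q_{ij}\in k^\times$ $(0\le i,j\le 3)$ satisfy $q_{ii}=q_{ij}q_{ji}=1$ and $q_{ij}^{h_i}=q_{ij}^{h_j}=1$ for all $i,j$. Let $$C=k\langle x_0,x_1,x_2,x_3\rangle/(x_jx_i-q_{ji}x_ix_j)_{i,j},\qquad \deg x_i=a_i,\qquad f=\sum_{i=0}^{3}x_i^{h_i}.$$ For a graded algebra $A$ let $\mathrm{gr}(A)$ be the category of finitely generated $\mathbb Z$-graded right $A$-modules, and let $\mathrm{qgr}(A)=\mathrm{gr}(A)/\mathrm{tor}(A)$ be its quotient by the torsion modules (those in which every element is annihilated by $A_{\ge s}$ for some $s$), with projection $\pi:\mathrm{gr}(A)\to\mathrm{qgr}(A)$. A module $M\in\mathrm{gr}(A)$ is $1$-critical if it has Gelfand--Kirillov dimension $1$ and every quotient of $M$ by a nonzero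 graded submodule has Gelfand--Kirillov dimension $<1$; its multiplicity is $\lim_{t\to1^-}(1-t)\sum_i(\dim_k M_i)t^i$. An ordinary (respectively thin) closed point of $\mathrm{proj}(A)$ is an isomorphism class of objects of $\mathrm{qgr}(A)$ that contains $\pi M$ for some $1$-critical $M\in\mathrm{gr}(A)$ of multiplicity $1$ (respectively $<1$). If the set of ordinary and thin closed points of $\mathrm{proj}(C/(f))$ is finite, then it has exactly $24$ elements. (This holds in particular for every such $(q_{ij})$ for which $\mathrm{proj}(C/(f))$ is a projective Calabi--Yau surface, i.e. has global dimension $2$ and the shift $[2]$ as the Serre functor of $D^b(\mathrm{qgr}(C/(f)))$.) -/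

import Mathlib

open CategoryTheory MulOpposite Filter Topology

universe u

noncomputable section

namespace QuantumWeighted

/-! ### Graded right modules and the quotient category `qgr`

`A` is a `k`-algebra and `𝒜 : ℕ → Submodule k A` is its grading.  Right `A`-modules are modules
over `Aᵐᵒᵖ`. -/

section Graded

variable (k : Type u) [Field k] {A : Type u} [Ring A] [Algebra k A] (𝒜 : ℕ → Submodule k A)

/-- A finitely generated `ℤ`-graded right `A`-module. -/
structure GrMod where
  carrier : Type u
  [addCommGroup : AddCommGroup carrier]
  [moduleBase : Module k carrier]
  [module : Module Aᵐᵒᵖ carrier]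
  [isScalarTower : IsScalarTower k Aᵐᵒᵖ carrier]
  /-- the homogeneous component `M_i` -/
  deg : ℤ → Submodule k carrier
  isInternal : DirectSum.IsInternal deg
  /-- `M_i A_j ⊆ M_{i+j}` -/
  smul_mem : ∀ (i : ℤ) (j : ℕ) (m : carrier) (r : A),
    m ∈ deg i → r ∈ 𝒜 j → op r • m ∈ deg (i + j)
  finite : Module.Finite Aᵐᵒᵖ carrier

attribute [instance] GrMod.addCommGroup GrMod.moduleBase GrMod.module GrMod.isScalarTower

variable {k} {𝒜}

/-- Morphisms in `gr(A)`: right `A`-linear maps of degree zero. -/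
@[ext]
structure GrMod.Hom (M N : GrMod k 𝒜) where
  toLin : M.carrier →ₗ[Aᵐᵒᵖ] N.carrier
  map_deg : ∀ (i : ℤ) (m : M.carrier), m ∈ M.deg i → toLin m ∈ N.deg i

/-- The category `gr(A)` of finitely generated graded right `A`-modules. -/
instance : Category (GrMod k 𝒜) where
  Hom := GrMod.Hom
  id M := ⟨LinearMap.id, fun _ _ h => h⟩
  comp f g := ⟨g.toLin ∘ₗ f.toLin, fun i m h => g.map_deg i _ (f.map_deg i m h)⟩

variable (k 𝒜) in
/-- The degree-zero maps whose kernel and cokernel are torsion, where a module is torsion if each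
of its elements is annihilated by `A_{≥ s}` for some `s`. -/
def torsionIso : MorphismProperty (GrMod k 𝒜) := fun M N f =>
  (∀ m : M.carrier, GrMod.Hom.toLin f m = 0 →
      ∃ s : ℕ, ∀ j ≥ s, ∀ r ∈ 𝒜 j, op r • m = 0) ∧
  (∀ n : N.carrier,
      ∃ s : ℕ, ∀ j ≥ s, ∀ r ∈ 𝒜 j, op r • n ∈ LinearMap.range (GrMod.Hom.toLin f))

variable (k 𝒜) in
/-- The quotient category `qgr(A) = gr(A)/tor(A)`, as the localization of `gr(A)` at the maps with
torsion kernel and torsion cokernel. -/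
abbrev Qgr := (torsionIso k 𝒜).Localization

variable (k 𝒜) in
/-- The projection `π : gr(A) ⥤ qgr(A)`. -/
abbrev proj : GrMod k 𝒜 ⥤ Qgr k 𝒜 := (torsionIso k 𝒜).Q

namespace GrMod

/-- The Hilbert function `i ↦ dim_k M_i`. -/
def hilb (M : GrMod k 𝒜) (i : ℤ) : ℕ := Module.finrank k (M.deg i)

/-- The Gelfand–Kirillov dimension of a finitely generated graded module,
`limsup_n log (∑_{|i| ≤ n} dim M_i) / log n`. -/
def gkdim (M : GrMod k 𝒜) : EReal :=
  limsup (fun n : ℕ =>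
    ((Real.log (∑ i ∈ Finset.Icc (-(n : ℤ)) n, (M.hilb i : ℝ)) / Real.log n : ℝ) : EReal)) atTop

/-- `M` is `1`-critical: it has GK-dimension `1`, and each of its quotients by a nonzero graded
submodule has GK-dimension `< 1`. -/
def IsOneCritical (M : GrMod k 𝒜) : Prop :=
  M.gkdim = 1 ∧
  ∀ (P : GrMod k 𝒜) (p : M ⟶ P), Function.Surjective (GrMod.Hom.toLin p) →
    ¬ Function.Injective (GrMod.Hom.toLin p) → P.gkdim < 1

/-- The module `M` of GK-dimension `1` has multiplicity `e = lim_{t → 1⁻} (1 - t) H_M(t)`, where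
`H_M(t) = ∑ (dim M_i) t^i` is the Hilbert series. -/
def HasMultiplicity (M : GrMod k 𝒜) (e : ℝ) : Prop :=
  Tendsto (fun t : ℝ => (1 - t) * ∑' i : ℤ, (M.hilb i : ℝ) * t ^ i) (𝓝[<] 1) (𝓝 e)

end GrMod

variable (k 𝒜) in
/-- The set of ordinary (multiplicity `1`) and thin (multiplicity `< 1`) closed points of
`proj(A)`: the isomorphism classes of objects of `qgr(A)` that are represented by a finitely
generated `1`-critical module of multiplicity at most `1`. -/
def ordinaryThinPoints : Set (Quotient (isIsomorphicSetoid (Qgr k 𝒜))) :=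
  {x | ∃ M : GrMod k 𝒜, M.IsOneCritical ∧ (∃ e : ℝ, M.HasMultiplicity e ∧ e ≤ 1) ∧
    x = Quotient.mk (isIsomorphicSetoid (Qgr k 𝒜)) ((proj k 𝒜).obj M)}

end Graded

/-! ### Quantum weighted hypersurfaces -/

section Hypersurface

variable {k : Type u} [Field k] {n : ℕ} (w : Fin n → ℕ) (q : Fin n → Fin n → k)

/-- The exponent `h_i = d / a_i`, where `d` is the sum of the weights. -/
def expo (i : Fin n) : ℕ := (∑ j, w j) / w i

/-- The relations `x_j x_i = q_{ji} x_i x_j` and `f = ∑ x_i ^ h_i = 0`. -/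
inductive Rel : FreeAlgebra k (Fin n) → FreeAlgebra k (Fin n) → Prop
  | comm (i j : Fin n) :
      Rel (FreeAlgebra.ι k j * FreeAlgebra.ι k i)
        (q j i • (FreeAlgebra.ι k i * FreeAlgebra.ι k j))
  | hyp : Rel (∑ i, FreeAlgebra.ι k i ^ expo w i) 0

/-- The algebra `C/(f)`, with `C = k⟨x_i⟩/(x_j x_i - q_{ji} x_i x_j)` and `f = ∑ x_i ^ h_i`. -/
abbrev HypAlg : Type u := RingQuot (Rel w q)

/-- The generator `x_i` of `C/(f)`. -/
def gen (i : Fin n) : HypAlg w q := RingQuot.mkAlgHom k (Rel w q) (FreeAlgebra.ι k i)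

/-- The grading of `C/(f)` with `deg x_i = w i`: the component of degree `m` is spanned by the
words of total weight `m` in the generators. -/
def hypGrading (m : ℕ) : Submodule k (HypAlg w q) :=
  Submodule.span k {y | ∃ l : List (Fin n), (l.map w).sum = m ∧ y = (l.map (gen w q)).prod}

end Hypersurface

end QuantumWeighted

end

/-!
Each generator `x_i` is normal, so on a `1`-critical module it acts injectively or as zero; call it
active in the first case. One active generator cannot satisfy the relation `∑ x_i ^ h_i = 0` on its
own, so there are at least two. If there are three, the central elements `x_i ^ h_i` have constant
ratios on the module, and rescaling the active generators compatibly with the relation changes these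
ratios in a one-parameter family, so the set of points is infinite.

If exactly `x_i` and `x_j` are active, then the module is determined in `qgr` by the residue modulo
`g = gcd(a_i, a_j)` of its large degrees and by the ratio `ν` of `x_j ^ (a_i / g)` to
`x_i ^ (a_j / g)`, which both have degree `lcm(a_i, a_j)`. The relation `x_i ^ h_i + x_j ^ h_j = 0`
becomes an equation `ν ^ m = c` with `c ≠ 0` and `m = d / lcm(a_i, a_j)`. Every residue and every
root occurs, so a finite set of points has `∑_{i < j} gcd(a_i, a_j) * (d / lcm(a_i, a_j))` elements,
which is `24` for each of the five choices of weights.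
-/

noncomputable section

namespace QuantumWeighted

lemma iSupIndep_of_projections {K ι V : Type*} [Ring K] [AddCommGroup V]
    [Module K V] {D : ι → Submodule K V}
    (p : ι → V →ₗ[K] V) (hp : ∀ i, ∀ v ∈ D i, p i v = v)
    (hp0 : ∀ i j, j ≠ i → ∀ v ∈ D j, p i v = 0) : iSupIndep D := by
  intro i
  rw [Submodule.disjoint_def]
  intro v hv hv'
  have hker : (⨆ j, ⨆ (_ : j ≠ i), D j) ≤ LinearMap.ker (p i) :=
    iSup₂_le fun j hj v hv => hp0 i j hj v hv
  exact (hp i v hv).symm.trans (hker hv')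

section GradedModules

variable {k : Type u} [Field k] {A : Type u} [Ring A] [Algebra k A] {𝒜 : ℕ → Submodule k A}

namespace GrMod

instance (M : GrMod k 𝒜) : DirectSum.Decomposition M.deg := M.isInternal.chooseDecomposition

/-- The projection of a graded module onto its component of degree `i`, as an endomorphism. -/
def component (M : GrMod k 𝒜) (i : ℤ) : M.carrier →ₗ[k] M.carrier :=
  (M.deg i).subtype ∘ₗ DirectSum.component k ℤ (fun i => M.deg i) i ∘ₗ
    (DirectSum.decomposeLinearEquiv M.deg).toLinearMap

/-- The map `r ↦ m r` attached to an element `m` of a right module. -/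
def orbit (M : GrMod k 𝒜) (m : M.carrier) : A →ₗ[k] M.carrier where
  toFun r := op r • m
  map_add' r s := by rw [MulOpposite.op_add, add_smul]
  map_smul' c r := by rw [op_smul, smul_assoc, RingHom.id_apply]

variable {M N : GrMod k 𝒜} {i j : ℤ} {m : M.carrier}

@[simp] lemma orbit_apply (m : M.carrier) (r : A) : M.orbit m r = op r • m := rfl

lemma component_mem (i : ℤ) (m : M.carrier) : M.component i m ∈ M.deg i :=
  Subtype.property _

lemma component_of_mem (hm : m ∈ M.deg i) : M.component i m = m :=
  DirectSum.decompose_of_mem_same M.deg hm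

lemma component_of_mem_ne (hm : m ∈ M.deg j) (hij : j ≠ i) : M.component i m = 0 :=
  DirectSum.decompose_of_mem_ne M.deg hm hij

lemma iSup_deg (M : GrMod k 𝒜) : ⨆ i, M.deg i = ⊤ :=
  M.isInternal.submodule_iSup_eq_top

lemma exists_component_ne_zero (hm : m ≠ 0) : ∃ i, M.component i m ≠ 0 := by
  classical
  by_contra! h
  refine hm ((DirectSum.sum_support_decompose M.deg m).symm.trans ?_)
  exact Finset.sum_eq_zero fun i _ => h i

lemma deg_eq_of_iSup_eq_top {U : ℤ → Submodule k M.carrier} (hU : ∀ i, U i ≤ M.deg i)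
    (htop : ⨆ i, U i = ⊤) (i : ℤ) : U i = M.deg i := by
  refine le_antisymm (hU i) fun m hm => ?_
  have hmap : (⨆ j, U j).map (M.component i) ≤ U i := by
    rw [Submodule.map_iSup, iSup_le_iff]
    rintro j _ ⟨x, hx, rfl⟩
    rcases eq_or_ne j i with rfl | hij
    · rwa [component_of_mem (hU j hx)]
    · rw [component_of_mem_ne (hU j hx) hij]
      exact zero_mem _
  rw [htop] at hmap
  exact hmap ⟨m, trivial, component_of_mem hm⟩

lemma orbit_map_le (hm : m ∈ M.deg i) (j : ℕ) : (𝒜 j).map (M.orbit m) ≤ M.deg (i + j) := by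
  rintro _ ⟨r, hr, rfl⟩
  exact M.smul_mem i j m r hm hr

lemma Hom.component_toLin (f : M ⟶ N) (i : ℤ) (m : M.carrier) :
    N.component i (Hom.toLin f m) = Hom.toLin f (M.component i m) := by
  induction m using DirectSum.Decomposition.inductionOn M.deg with
  | zero => simp only [map_zero]
  | @homogeneous j m =>
    have hfm := Hom.map_deg f j m m.2
    rcases eq_or_ne j i with rfl | hij
    · rw [component_of_mem hfm, component_of_mem m.2]
    · rw [component_of_mem_ne hfm hij, component_of_mem_ne m.2 hij, map_zero]
  | add x y hx hy => simp only [map_add, hx, hy]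

/-- The quotient of a graded module by a graded submodule. -/
def quot (M : GrMod k 𝒜) (K : Submodule Aᵐᵒᵖ M.carrier) (hK : K.IsHomogeneous M.deg) :
    GrMod k 𝒜 where
  carrier := M.carrier ⧸ K
  deg i := (M.deg i).map (K.mkQ.restrictScalars k)
  isInternal := by
    refine DirectSum.isInternal_submodule_of_iSupIndep_of_iSup_eq_top ?_ ?_
    · refine iSupIndep_of_projections
        (fun i => Submodule.mapQ (K.restrictScalars k) (K.restrictScalars k) (M.component i)
          fun m hm => hK i hm) ?_ ?_
      · rintro i _ ⟨m, hm, rfl⟩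
        exact congrArg K.mkQ (component_of_mem hm)
      · rintro i j hij _ ⟨m, hm, rfl⟩
        exact (congrArg K.mkQ (component_of_mem_ne hm hij)).trans (map_zero _)
    · rw [← Submodule.map_iSup, M.iSup_deg, Submodule.map_top, LinearMap.range_eq_top]
      exact K.mkQ_surjective
  smul_mem := by
    rintro i j _ r ⟨m, hm, rfl⟩ hr
    exact ⟨op r • m, M.smul_mem i j m r hm hr, rfl⟩
  finite := by
    have := M.finite
    infer_instance

/-- The projection onto the quotient by a graded submodule. -/
def quotMk (M : GrMod k 𝒜) (K : Submodule Aᵐᵒᵖ M.carrier) (hK : K.IsHomogeneous M.deg) :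
    M ⟶ M.quot K hK :=
  Hom.mk (N := M.quot K hK) K.mkQ fun _ m hm => ⟨m, hm, rfl⟩

lemma exists_homogeneous_generators (M : GrMod k 𝒜) :
    ∃ (s : Finset M.carrier) (δ : M.carrier → ℤ), (∀ m ∈ s, m ∈ M.deg (δ m)) ∧
      Submodule.span Aᵐᵒᵖ (s : Set M.carrier) = ⊤ := by
  have hspan : Submodule.span Aᵐᵒᵖ {m | ∃ i, m ∈ M.deg i} = ⊤ := by
    refine eq_top_iff.2 fun m _ => ?_
    induction m using DirectSum.Decomposition.inductionOn M.deg with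
    | zero => exact zero_mem _
    | @homogeneous i m => exact Submodule.subset_span ⟨i, m.2⟩
    | add x y hx hy => exact add_mem (hx trivial) (hy trivial)
  obtain ⟨s, hs, hs'⟩ := Submodule.fg_span_iff_fg_span_finset_subset _ |>.1
    (hspan ▸ M.finite.fg_top)
  choose! δ hδ using hs
  exact ⟨s, δ, hδ, hs'.symm.trans hspan⟩

lemma deg_eq_iSup_orbit_map (h𝒜 : ⨆ j, 𝒜 j = ⊤) {s : Finset M.carrier} {δ : M.carrier → ℤ}
    (hδ : ∀ m ∈ s, m ∈ M.deg (δ m))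
    (hs : Submodule.span Aᵐᵒᵖ (s : Set M.carrier) = ⊤) (i : ℤ) :
    M.deg i = ⨆ m ∈ s, ⨆ (j : ℕ) (_ : δ m + j = i), (𝒜 j).map (M.orbit m) := by
  refine (deg_eq_of_iSup_eq_top
    (U := fun i => ⨆ m ∈ s, ⨆ (j : ℕ) (_ : δ m + j = i), (𝒜 j).map (M.orbit m))
    (fun i => ?_) ?_ i).symm
  · refine iSup₂_le fun m hm => iSup₂_le ?_
    rintro j rfl
    exact orbit_map_le (hδ m hm) j
  · refine eq_top_iff.2 fun x _ => ?_
    obtain ⟨c, -, rfl⟩ := Submodule.mem_span_finset.1 (hs ▸ Submodule.mem_top (x := x))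
    refine sum_mem fun m hm => ?_
    have hmem : M.orbit m (c m).unop ∈ (⨆ j, 𝒜 j).map (M.orbit m) := ⟨_, h𝒜 ▸ trivial, rfl⟩
    rw [Submodule.map_iSup] at hmem
    refine SetLike.le_def.1 (iSup_le fun j => ?_) hmem
    exact le_iSup_of_le (δ m + j) (le_iSup₂_of_le m hm (le_iSup₂_of_le j rfl le_rfl))

end GrMod

end GradedModules

section Growth

/-- The algebra `A` is graded by `𝒜`, with finite-dimensional components, and is generated by
elements of bounded positive degree; the bound appears as a factorization of the elements of
large degree. -/
class IsFGGrading {k A : Type*} [Field k] [Ring A] [Algebra k A] (𝒜 : ℕ → Submodule k A) : Prop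
    extends SetLike.GradedMonoid 𝒜 where
  iSup_eq_top : ⨆ i, 𝒜 i = ⊤
  finiteDimensional (i : ℕ) : FiniteDimensional k (𝒜 i)
  exists_bound : ∃ B : ℕ, ∀ i > B, 𝒜 i ≤ ⨆ j ∈ Finset.Icc 1 B, 𝒜 (i - j) * 𝒜 j

lemma IsFGGrading.exists_factorization {k A : Type*} [Field k] [Ring A] [Algebra k A]
    (𝒜 : ℕ → Submodule k A) [IsFGGrading 𝒜] :
    ∃ B : ℕ, ∀ s, ∀ j ≥ s, 𝒜 j ≤ ⨆ i ∈ Finset.Icc s (min j (s + B)), 𝒜 i * 𝒜 (j - i) := by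
  obtain ⟨B, hB⟩ := exists_bound (𝒜 := 𝒜)
  refine ⟨B, fun s j => ?_⟩
  induction j using Nat.strong_induction_on with
  | _ j ih =>
    intro hsj
    rcases le_or_gt j (s + B) with hj | hj
    · intro r hr
      refine SetLike.le_def.1 (le_iSup₂_of_le j (by simp [hsj, hj]) le_rfl) ?_
      rw [← mul_one r]
      exact Submodule.mul_mem_mul hr (by simpa using SetLike.GradedOne.one_mem)
    · refine (hB j (by omega)).trans (iSup₂_le fun l hl => ?_)
      rw [Finset.mem_Icc] at hl
      refine (mul_le_mul_left (ih (j - l) (by omega) (by omega)) _).trans ?_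
      simp only [Submodule.iSup_mul]
      refine iSup₂_le fun i hi => ?_
      rw [Finset.mem_Icc] at hi
      refine le_iSup₂_of_le i (by simp only [Finset.mem_Icc]; omega) ?_
      rw [mul_assoc, show j - i = j - l - i + l by omega]
      exact mul_le_mul_right (Submodule.mul_le.2 fun _ hx _ hy => SetLike.mul_mem_graded hx hy) _

variable {k : Type u} [Field k] {A : Type u} [Ring A] [Algebra k A] {𝒜 : ℕ → Submodule k A}

namespace GrMod

section

variable [IsFGGrading 𝒜]

instance finiteDimensional_deg (M : GrMod k 𝒜) (i : ℤ) : FiniteDimensional k (M.deg i) := by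
  obtain ⟨s, δ, hδ, hs⟩ := M.exists_homogeneous_generators
  have hle : M.deg i ≤ ⨆ m ∈ s, (𝒜 (i - δ m).toNat).map (M.orbit m) := by
    rw [deg_eq_iSup_orbit_map IsFGGrading.iSup_eq_top hδ hs]
    refine iSup₂_le fun m hm => iSup₂_le fun j hj => le_iSup₂_of_le m hm ?_
    rw [show (i - δ m).toNat = j by omega]
  rw [← Finset.sup_eq_iSup] at hle
  have (m : M.carrier) := IsFGGrading.finiteDimensional (𝒜 := 𝒜) (i - δ m).toNat
  exact Submodule.finiteDimensional_of_le hle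

lemma hilb_pos_iff {M : GrMod k 𝒜} {i : ℤ} : 0 < M.hilb i ↔ M.deg i ≠ ⊥ :=
  Submodule.one_le_finrank_iff

lemma exists_lower_bound (M : GrMod k 𝒜) : ∃ N : ℤ, ∀ i < N, M.deg i = ⊥ := by
  obtain ⟨s, δ, hδ, hs⟩ := M.exists_homogeneous_generators
  obtain ⟨N, hN⟩ := (s.finite_toSet.image δ).bddBelow
  refine ⟨N, fun i hi => eq_bot_iff.2 ?_⟩
  rw [deg_eq_iSup_orbit_map IsFGGrading.iSup_eq_top hδ hs]
  refine iSup₂_le fun m hm => iSup₂_le fun j hj => ?_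
  have := hN ⟨m, hm, rfl⟩
  omega

lemma exists_deg_eq_bot_of_window (M : GrMod k 𝒜) :
    ∃ (B : ℕ) (N : ℤ), ∀ i ≥ N, (∀ j, i ≤ j → j < i + B → M.deg j = ⊥) →
      ∀ j ≥ i, M.deg j = ⊥ := by
  obtain ⟨s, δ, hδ, hs⟩ := M.exists_homogeneous_generators
  obtain ⟨N, hN⟩ := (s.finite_toSet.image δ).bddAbove
  obtain ⟨B, hB⟩ := IsFGGrading.exists_bound (𝒜 := 𝒜)
  refine ⟨B, N + 1, fun i hi hwindow j hj => ?_⟩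
  obtain ⟨t, rfl⟩ : ∃ t : ℕ, j = i + t := ⟨(j - i).toNat, by omega⟩
  clear hj
  induction t using Nat.strong_induction_on with
  | _ t ih =>
    by_cases ht : t < B
    · exact hwindow _ (by omega) (by omega)
    rw [eq_bot_iff, deg_eq_iSup_orbit_map IsFGGrading.iSup_eq_top hδ hs]
    refine iSup₂_le fun m hm => iSup₂_le fun d hd => ?_
    have hmN := hN ⟨m, hm, rfl⟩
    rw [Submodule.map_le_iff_le_comap]
    refine (hB d (by omega)).trans (iSup₂_le fun l hl => Submodule.mul_le.2 fun a ha b _ => ?_)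
    rw [Finset.mem_Icc] at hl
    have ham := M.smul_mem _ _ m a (hδ m hm) ha
    rw [show δ m + ((d - l : ℕ) : ℤ) = i + ((t - l : ℕ) : ℤ) by omega, ih (t - l) (by omega),
      Submodule.mem_bot] at ham
    rw [Submodule.mem_comap, orbit_apply, op_mul, mul_smul, ham, smul_zero]
    exact zero_mem _

end

end GrMod

lemma le_sum_range_mul_of_no_gap {g : ℕ → ℕ} {B : ℕ} (hg : ∀ i, ∃ j < B, g (i + j) ≠ 0) (t : ℕ) :
    t ≤ ∑ x ∈ Finset.range (t * B), g x := by
  induction t with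
  | zero => exact Nat.zero_le _
  | succ t ih =>
    obtain ⟨j, hjB, hj⟩ := hg (t * B)
    have hblock : g (t * B + j) ≤ ∑ x ∈ Finset.range B, g (t * B + x) :=
      Finset.single_le_sum (f := fun x => g (t * B + x)) (fun _ _ => Nat.zero_le _)
        (Finset.mem_range.2 hjB)
    rw [add_one_mul, Finset.sum_range_add]
    omega

lemma exists_mul_le_sum_Icc {g : ℤ → ℕ} {B : ℕ} {N : ℤ}
    (hg : ∀ i ≥ N, ∃ j < B, g (i + j) ≠ 0) :
    ∃ c > (0 : ℝ), ∀ᶠ m : ℕ in atTop, c * m ≤ ∑ i ∈ Finset.Icc (-(m : ℤ)) m, (g i : ℝ) := by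
  have hB : 0 < B := by
    obtain ⟨j, hj, -⟩ := hg N le_rfl
    omega
  set L := N.toNat
  refine ⟨1 / (2 * B), by positivity, ?_⟩
  filter_upwards [eventually_ge_atTop (2 * (L + B))] with m hm
  set T := (m - L) / B
  have hTB : T * B ≤ m - L := Nat.div_mul_le_self _ _
  have hTB' : m - L < T * B + B := Nat.lt_div_mul_add hB
  have hsum : T ≤ ∑ x ∈ Finset.range (T * B), g (L + x) :=
    le_sum_range_mul_of_no_gap (g := fun x => g (L + x)) (fun i => by
      simpa only [Nat.cast_add, add_assoc] using hg (L + i) (by omega)) T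
  have hsub : ∑ x ∈ Finset.range (T * B), g (L + x) ≤ ∑ i ∈ Finset.Icc (-(m : ℤ)) m, g i := by
    rw [← Finset.sum_image (f := g) (g := fun x : ℕ => (L : ℤ) + x)
      fun x _ y _ h => by simpa using h]
    refine Finset.sum_le_sum_of_subset fun i hi => ?_
    obtain ⟨x, hx, rfl⟩ := Finset.mem_image.1 hi
    rw [Finset.mem_range] at hx
    rw [Finset.mem_Icc]
    omega
  have hm2 : (m : ℝ) ≤ 2 * B * T := by
    have : m ≤ 2 * B * T := by nlinarith [Nat.sub_add_cancel (show L ≤ m by omega)]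
    exact_mod_cast this
  calc 1 / (2 * B) * (m : ℝ) ≤ T := by
        rw [one_div_mul_eq_div, div_le_iff₀ (by positivity)]
        linarith
    _ ≤ _ := by exact_mod_cast hsum.trans hsub

lemma tendsto_log_mul_div_log {c : ℝ} (hc : 0 < c) :
    Tendsto (fun m : ℕ => Real.log (c * m) / Real.log m) atTop (𝓝 1) := by
  have hlog : Tendsto (fun m : ℕ => Real.log (m : ℝ)) atTop atTop :=
    Real.tendsto_log_atTop.comp tendsto_natCast_atTop_atTop
  have hlim : Tendsto (fun m : ℕ => Real.log c / Real.log m + 1) atTop (𝓝 (0 + 1)) :=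
    (hlog.const_div_atTop _).add_const 1
  rw [zero_add] at hlim
  refine hlim.congr' ?_
  filter_upwards [hlog.eventually_gt_atTop 0, eventually_gt_atTop 0] with m hlogm hm
  rw [Real.log_mul hc.ne' (by positivity), add_div, div_self hlogm.ne']

namespace GrMod

lemma le_gkdim {M : GrMod k 𝒜} {u : ℕ → ℝ} {e : ℝ} (hu : ∀ᶠ m in atTop, 0 < u m)
    (hlim : Tendsto (fun m : ℕ => Real.log (u m) / Real.log m) atTop (𝓝 e))
    (hle : ∀ᶠ m : ℕ in atTop, u m ≤ ∑ i ∈ Finset.Icc (-(m : ℤ)) m, (M.hilb i : ℝ)) :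
    e ≤ M.gkdim := by
  rw [← ((continuous_coe_real_ereal.tendsto e).comp hlim).limsup_eq]
  refine limsup_le_limsup ?_
  filter_upwards [hu, hle] with m hum hm
  simp only [Function.comp_apply, EReal.coe_le_coe_iff]
  gcongr

lemma gkdim_le {M : GrMod k 𝒜} {u : ℕ → ℝ} {e : ℝ} (hu : ∀ᶠ m in atTop, 1 ≤ u m)
    (hlim : Tendsto (fun m : ℕ => Real.log (u m) / Real.log m) atTop (𝓝 e))
    (hle : ∀ᶠ m : ℕ in atTop, ∑ i ∈ Finset.Icc (-(m : ℤ)) m, (M.hilb i : ℝ) ≤ u m) :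
    M.gkdim ≤ e := by
  rw [← ((continuous_coe_real_ereal.tendsto e).comp hlim).limsup_eq]
  refine limsup_le_limsup ?_
  filter_upwards [hle, hu] with m hm hum
  have hlog : 0 ≤ Real.log m := Real.log_natCast_nonneg m
  simp only [Function.comp_apply, EReal.coe_le_coe_iff]
  refine div_le_div_of_nonneg_right ?_ hlog
  have hsum : 0 ≤ ∑ i ∈ Finset.Icc (-(m : ℤ)) m, (M.hilb i : ℝ) :=
    Finset.sum_nonneg fun _ _ => Nat.cast_nonneg _
  rcases hsum.eq_or_lt with h0 | h0
  · rw [← h0, Real.log_zero]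
    exact Real.log_nonneg hum
  · exact Real.log_le_log h0 hm

lemma one_le_gkdim {M : GrMod k 𝒜} {B : ℕ} {N : ℤ}
    (hM : ∀ i ≥ N, ∃ j < B, M.hilb (i + j) ≠ 0) : 1 ≤ M.gkdim := by
  obtain ⟨c, hc, hle⟩ := exists_mul_le_sum_Icc hM
  exact le_gkdim ((eventually_gt_atTop 0).mono fun m hm => by positivity)
    (tendsto_log_mul_div_log hc) hle

lemma gkdim_le_one {M : GrMod k 𝒜} (hM : ∀ i, M.hilb i ≤ 1) : M.gkdim ≤ 1 := by
  have hlarge := (eventually_ge_atTop 1).mono fun (m : ℕ) hm => (Nat.one_le_cast (α := ℝ)).2 hm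
  refine gkdim_le (u := fun m => 3 * m) (hlarge.mono fun m hm => by linarith)
    (tendsto_log_mul_div_log three_pos) (hlarge.mono fun m hm => ?_)
  have hcard : ((m : ℤ) + 1 - -(m : ℤ)).toNat = 2 * m + 1 := by omega
  calc ∑ i ∈ Finset.Icc (-(m : ℤ)) m, (M.hilb i : ℝ)
      ≤ ∑ _i ∈ Finset.Icc (-(m : ℤ)) m, (1 : ℝ) :=
        Finset.sum_le_sum fun i _ => by exact_mod_cast hM i
    _ = 2 * m + 1 := by
        rw [Finset.sum_const, Int.card_Icc, hcard, nsmul_one]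
        push_cast
        ring
    _ ≤ 3 * m := by linarith

variable [IsFGGrading 𝒜]

lemma gkdim_lt_one_of_deg_eq_bot {M : GrMod k 𝒜} {N : ℤ} (hM : ∀ i ≥ N, M.deg i = ⊥) :
    M.gkdim < 1 := by
  obtain ⟨L, hL⟩ := M.exists_lower_bound
  have hsupport : ∀ i, M.hilb i ≠ 0 → i ∈ Finset.Icc L N := by
    intro i hi
    rw [← Nat.pos_iff_ne_zero, hilb_pos_iff] at hi
    by_contra hmem
    rw [Finset.mem_Icc, not_and_or] at hmem
    exact hi (hmem.elim (fun h => hL i (by omega)) fun h => hM i (by omega))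
  have hsum (m : ℕ) : ∑ i ∈ Finset.Icc (-(m : ℤ)) m, (M.hilb i : ℝ) ≤
      ∑ i ∈ Finset.Icc L N, (M.hilb i : ℝ) :=
    mod_cast Finset.sum_le_sum_of_ne_zero fun i _ hi => hsupport i hi
  refine (gkdim_le (u := fun _ => 1 + ∑ i ∈ Finset.Icc L N, (M.hilb i : ℝ)) (e := 0)
    ?_ ?_ ?_).trans_lt (by exact_mod_cast zero_lt_one)
  · exact Eventually.of_forall fun _ =>
      le_add_of_nonneg_right (Finset.sum_nonneg fun _ _ => Nat.cast_nonneg _)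
  · exact (Real.tendsto_log_atTop.comp tendsto_natCast_atTop_atTop).const_div_atTop _
  · exact Eventually.of_forall fun m => (hsum m).trans (le_add_of_nonneg_left zero_le_one)

lemma exists_deg_eq_bot_of_gkdim_lt_one {M : GrMod k 𝒜} (hM : M.gkdim < 1) :
    ∃ N : ℤ, ∀ i ≥ N, M.deg i = ⊥ := by
  obtain ⟨B, N, hN⟩ := M.exists_deg_eq_bot_of_window
  by_contra! hne
  refine hM.not_ge (one_le_gkdim (B := B) (N := N) fun i hi => ?_)
  by_contra! hgap
  obtain ⟨j, hj, hj'⟩ := hne i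
  refine hj' (hN i hi (fun l hil hl => ?_) j hj)
  have hzero := hgap (l - i).toNat (by omega)
  rwa [show i + ((l - i).toNat : ℤ) = l by omega, ← Nat.le_zero, ← not_lt, hilb_pos_iff,
    not_not] at hzero

end GrMod

end Growth

section Torsion

variable {k : Type u} [Field k] {A : Type u} [Ring A] [Algebra k A] {𝒜 : ℕ → Submodule k A}

namespace GrMod

/-- The elements annihilated by all homogeneous elements of degree at least `s`. -/
def torsionFrom (M : GrMod k 𝒜) (s : ℕ) : Submodule k M.carrier where
  carrier := {m | ∀ j ≥ s, ∀ r ∈ 𝒜 j, op r • m = 0}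
  add_mem' hx hy j hj r hr := by rw [smul_add, hx j hj r hr, hy j hj r hr, add_zero]
  zero_mem' _ _ _ _ := smul_zero _
  smul_mem' c x hx j hj r hr := by rw [smul_comm, hx j hj r hr, smul_zero]

/-- The torsion submodule: the elements annihilated by `A_{≥ s}` for some `s`. -/
def torsion (M : GrMod k 𝒜) : Submodule k M.carrier := ⨆ s, M.torsionFrom s

variable {M N : GrMod k 𝒜} {i : ℤ} {m : M.carrier}

lemma torsionFrom_mono : Monotone M.torsionFrom :=
  fun _ _ hst _ hm j hj => hm j (hst.trans hj)

lemma mem_torsion_iff : m ∈ M.torsion ↔ ∃ s, m ∈ M.torsionFrom s :=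
  Submodule.mem_iSup_of_directed _ torsionFrom_mono.directed_le

lemma exists_le_torsionFrom {V : Submodule k M.carrier} [FiniteDimensional k V]
    (hV : V ≤ M.torsion) : ∃ s, V ≤ M.torsionFrom s := by
  have hcompact := (Submodule.fg_iff_compact V).1 (V.fg_iff_finiteDimensional.2 ‹_›)
  obtain ⟨S, hS⟩ :=
    CompleteLattice.IsCompactElement.exists_finset_of_le_iSup _ hcompact _ hV
  exact ⟨S.sup id, hS.trans (iSup₂_le fun s hs => torsionFrom_mono (Finset.le_sup (f := id) hs))⟩

lemma Hom.map_mem_torsion (f : M ⟶ N) (hm : m ∈ M.torsion) : Hom.toLin f m ∈ N.torsion := by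
  obtain ⟨s, hs⟩ := mem_torsion_iff.1 hm
  exact mem_torsion_iff.2 ⟨s, fun j hj r hr => by rw [← map_smul, hs j hj r hr, map_zero]⟩

lemma component_smul {r : A} {j : ℕ} (hr : r ∈ 𝒜 j) (i : ℤ) (m : M.carrier) :
    M.component (i + j) (op r • m) = op r • M.component i m := by
  induction m using DirectSum.Decomposition.inductionOn M.deg with
  | zero => simp only [smul_zero, map_zero]
  | @homogeneous l m =>
    have hrm := M.smul_mem l j m r m.2 hr
    rcases eq_or_ne l i with rfl | hli
    · rw [component_of_mem hrm, component_of_mem m.2]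
    · rw [component_of_mem_ne hrm (by omega), component_of_mem_ne m.2 hli, smul_zero]
  | add x y hx hy => simp only [smul_add, map_add, hx, hy]

lemma component_mem_torsion (hm : m ∈ M.torsion) (i : ℤ) : M.component i m ∈ M.torsion := by
  obtain ⟨s, hs⟩ := mem_torsion_iff.1 hm
  exact mem_torsion_iff.2 ⟨s, fun j hj r hr => by
    rw [← component_smul hr, hs j hj r hr, map_zero]⟩

end GrMod

namespace torsionIso

variable [IsFGGrading 𝒜] {M N : GrMod k 𝒜} {f : M ⟶ N}

lemma mem_torsion_of_map (hf : torsionIso k 𝒜 f) {x : M.carrier}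
    (hx : GrMod.Hom.toLin f x ∈ N.torsion) : x ∈ M.torsion := by
  obtain ⟨s, hs⟩ := GrMod.mem_torsion_iff.1 hx
  obtain ⟨B, hB⟩ := IsFGGrading.exists_factorization 𝒜
  set V := (Finset.Icc s (s + B)).sup fun i => (𝒜 i).map (M.orbit x)
  have hV : V ≤ M.torsion := by
    refine Finset.sup_le fun i hi => ?_
    rintro _ ⟨r, hr, rfl⟩
    refine GrMod.mem_torsion_iff.2 (hf.1 _ ?_)
    rw [GrMod.orbit_apply, map_smul, hs i (Finset.mem_Icc.1 hi).1 r hr]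
  have (i : ℕ) := IsFGGrading.finiteDimensional (𝒜 := 𝒜) i
  obtain ⟨t, ht⟩ := GrMod.exists_le_torsionFrom hV
  refine GrMod.mem_torsion_iff.2 ⟨s + B + t, fun j hj r hr => ?_⟩
  have hle : 𝒜 j ≤ LinearMap.ker (M.orbit x) := by
    refine (hB s j (by omega)).trans (iSup₂_le fun i hi => Submodule.mul_le.2 fun a ha b hb => ?_)
    rw [Finset.mem_Icc, le_min_iff] at hi
    have haV : op a • x ∈ V := (Finset.le_sup (f := fun i => (𝒜 i).map (M.orbit x))
      (Finset.mem_Icc.2 ⟨hi.1, hi.2.2⟩) : _ ≤ V) ⟨a, ha, rfl⟩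
    rw [LinearMap.mem_ker, GrMod.orbit_apply, op_mul, mul_smul]
    exact ht haV (j - i) (by omega) b hb
  exact hle hr

lemma exists_surjOn_deg (hf : torsionIso k 𝒜 f) :
    ∃ L : ℤ, ∀ i ≥ L, ∀ y ∈ N.deg i, ∃ x ∈ M.deg i, GrMod.Hom.toLin f x = y := by
  obtain ⟨s, δ, hδ, hs⟩ := N.exists_homogeneous_generators
  choose t ht using hf.2
  obtain ⟨L, hL⟩ := (s.finite_toSet.image fun m => δ m + (t m : ℤ)).bddAbove
  refine ⟨L, fun i hi y hy => ?_⟩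
  have hle : N.deg i ≤ (LinearMap.range (GrMod.Hom.toLin f)).restrictScalars k := by
    rw [GrMod.deg_eq_iSup_orbit_map IsFGGrading.iSup_eq_top hδ hs]
    refine iSup₂_le fun m hm => iSup₂_le fun j hj => ?_
    have hmL : δ m + (t m : ℤ) ≤ L := hL ⟨m, hm, rfl⟩
    rintro _ ⟨r, hr, rfl⟩
    exact ht m j (by omega) r hr
  obtain ⟨x, rfl⟩ := hle hy
  exact ⟨M.component i x, GrMod.component_mem i x, by
    rw [← GrMod.Hom.component_toLin, GrMod.component_of_mem hy]⟩

end torsionIso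

/-! ### Germs at infinity -/

/-- The sequences of homogeneous elements that `z` maps to torsion along the filter `l`. -/
def germKer (l : Filter ℤ) (z : A) (M : GrMod k 𝒜) : Submodule k (∀ i, M.deg i) where
  carrier := {m | ∀ᶠ i in l, op z • (m i : M.carrier) ∈ M.torsion}
  add_mem' hx hy := by
    filter_upwards [hx, hy] with i hxi hyi
    simpa only [Pi.add_apply, Submodule.coe_add, smul_add] using add_mem hxi hyi
  zero_mem' := Eventually.of_forall fun i => by
    simpa only [Pi.zero_apply, Submodule.coe_zero, smul_zero] using zero_mem _
  smul_mem' c x hx := by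
    filter_upwards [hx] with i hxi
    simpa only [Pi.smul_apply, Submodule.coe_smul, smul_comm (op z) c] using
      Submodule.smul_mem _ c hxi

/-- The action of a morphism of graded modules on sequences of homogeneous elements. -/
def GrMod.Hom.piMap {M N : GrMod k 𝒜} (f : M ⟶ N) : (∀ i, M.deg i) →ₗ[k] ∀ i, N.deg i :=
  LinearMap.pi fun i =>
    ((GrMod.Hom.toLin f).restrictScalars k).restrict (GrMod.Hom.map_deg f i) ∘ₗ LinearMap.proj i

lemma GrMod.Hom.germKer_le_comap (l : Filter ℤ) (z : A) {M N : GrMod k 𝒜} (f : M ⟶ N) :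
    germKer l z M ≤ (germKer l z N).comap (GrMod.Hom.piMap f) := fun m hm => by
  filter_upwards [show ∀ᶠ i in l, op z • (m i : M.carrier) ∈ M.torsion from hm] with i hi
  exact map_smul (GrMod.Hom.toLin f) (op z) (m i : M.carrier) ▸ GrMod.Hom.map_mem_torsion f hi

/-- The functor of germs of sequences of homogeneous elements, two sequences being identified when
`z` maps their difference to torsion along `l`. For `l ≤ atTop` it factors through `qgr(A)`, and so
detects how `z` acts on an object of `qgr(A)`. -/
def germFunctor (k : Type u) [Field k] {A : Type u} [Ring A] [Algebra k A] (𝒜 : ℕ → Submodule k A)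
    (l : Filter ℤ) (z : A) : GrMod k 𝒜 ⥤ ModuleCat.{u} k where
  obj M := ModuleCat.of k ((∀ i, M.deg i) ⧸ germKer l z M)
  map f := ModuleCat.ofHom (Submodule.mapQ _ _ _ (GrMod.Hom.germKer_le_comap l z f))
  map_id _ := ModuleCat.hom_ext (Submodule.linearMap_qext _ rfl)
  map_comp _ _ := ModuleCat.hom_ext (Submodule.linearMap_qext _ rfl)

lemma germFunctor_isInvertedBy [IsFGGrading 𝒜] {l : Filter ℤ} (hl : l ≤ atTop) (z : A) :
    (torsionIso k 𝒜).IsInvertedBy (germFunctor k 𝒜 l z) := by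
  intro M N f hf
  rw [ConcreteCategory.isIso_iff_bijective]
  refine ⟨(injective_iff_map_eq_zero _).2 fun x hx => ?_, fun y => ?_⟩
  · obtain ⟨m, rfl⟩ := Submodule.mkQ_surjective _ x
    refine (Submodule.Quotient.mk_eq_zero _).2 ?_
    filter_upwards [show ∀ᶠ i in l, op z • GrMod.Hom.toLin f (m i) ∈ N.torsion from
      (Submodule.Quotient.mk_eq_zero _).1 hx] with i hi
    exact hf.mem_torsion_of_map (by rwa [map_smul])
  · obtain ⟨m, rfl⟩ := Submodule.mkQ_surjective _ y
    obtain ⟨L, hL⟩ := hf.exists_surjOn_deg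
    have hlift (i : ℤ) : ∃ x : M.deg i, i ≥ L → GrMod.Hom.toLin f x = m i := by
      by_cases hi : i ≥ L
      · obtain ⟨x, hx, hxm⟩ := hL i hi (m i) (m i).2
        exact ⟨⟨x, hx⟩, fun _ => hxm⟩
      · exact ⟨0, fun h => absurd h hi⟩
    choose x hx using hlift
    refine ⟨Submodule.mkQ _ x, (Submodule.Quotient.eq _).2 ?_⟩
    filter_upwards [hl (eventually_ge_atTop L)] with i hi
    have hzero : ((GrMod.Hom.piMap f x - m) i : N.carrier) = 0 := sub_eq_zero.2 (hx i hi)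
    rw [hzero, smul_zero]
    exact zero_mem _

lemma subsingleton_germ_iff {l : Filter ℤ} {z : A} {M : GrMod k 𝒜} :
    Subsingleton ((germFunctor k 𝒜 l z).obj M) ↔
      ∀ᶠ i in l, ∀ m ∈ M.deg i, op z • m ∈ M.torsion := by
  refine (Submodule.Quotient.subsingleton_iff).trans ⟨fun htop => ?_, fun hM => ?_⟩
  · have hbad (i : ℤ) : ∃ m : M.deg i,
        op z • (m : M.carrier) ∈ M.torsion → ∀ m ∈ M.deg i, op z • m ∈ M.torsion := by
      by_contra! hi
      obtain ⟨-, m, hm, hmz⟩ := hi 0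
      exact hmz (hi ⟨m, hm⟩).1
    choose m hm using hbad
    have hmem : m ∈ germKer l z M := htop ▸ Submodule.mem_top
    filter_upwards [show ∀ᶠ i in l, op z • (m i : M.carrier) ∈ M.torsion from hmem] with i
      using hm i
  · refine eq_top_iff.2 fun m _ => ?_
    filter_upwards [hM] with i hi using hi _ (m i).2

/-- The class of `πM` in the set of isomorphism classes of `qgr(A)`. -/
def GrMod.qgrClass (M : GrMod k 𝒜) : Quotient (isIsomorphicSetoid (Qgr k 𝒜)) :=
  Quotient.mk _ ((proj k 𝒜).obj M)

lemma torsionIso.qgrClass_eq {M N : GrMod k 𝒜} {f : M ⟶ N} (hf : torsionIso k 𝒜 f) :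
    M.qgrClass = N.qgrClass :=
  Quotient.sound ⟨Localization.Construction.wIso f hf⟩

lemma eventually_smul_mem_torsion_of_qgrClass_eq [IsFGGrading 𝒜] {l : Filter ℤ} (hl : l ≤ atTop)
    {z : A} {M N : GrMod k 𝒜} (hMN : M.qgrClass = N.qgrClass)
    (hM : ∀ᶠ i in l, ∀ m ∈ M.deg i, op z • m ∈ M.torsion) :
    ∀ᶠ i in l, ∀ m ∈ N.deg i, op z • m ∈ N.torsion := by
  obtain ⟨e⟩ := Quotient.exact hMN
  let F := Localization.Construction.lift (germFunctor k 𝒜 l z) (germFunctor_isInvertedBy hl z)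
  have e' : (germFunctor k 𝒜 l z).obj M ≅ (germFunctor k 𝒜 l z).obj N := F.mapIso e
  rw [← subsingleton_germ_iff] at hM ⊢
  exact e'.toLinearEquiv.toEquiv.symm.subsingleton

end Torsion

section Critical

variable {k : Type u} [Field k] {A : Type u} [Ring A] [Algebra k A] {𝒜 : ℕ → Submodule k A}

namespace GrMod

/-- A finitely generated graded submodule, as a graded module. -/
def sub (M : GrMod k 𝒜) (K : Submodule Aᵐᵒᵖ M.carrier) (hK : K.IsHomogeneous M.deg) (hfin : K.FG) :
    GrMod k 𝒜 where
  carrier := K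
  deg i := (M.deg i).comap (K.subtype.restrictScalars k)
  isInternal := by
    classical
    refine DirectSum.isInternal_submodule_of_iSupIndep_of_iSup_eq_top ?_ ?_
    · exact iSupIndep_of_projections
        (fun i => (M.component i).restrict (p := K.restrictScalars k) (q := K.restrictScalars k)
          fun m hm => hK i hm)
        (fun i m hm => Subtype.ext (component_of_mem hm))
        (fun i j hij m hm => Subtype.ext (component_of_mem_ne hm hij))
    · refine eq_top_iff.2 fun m _ => ?_
      have hm : m = ∑ i ∈ (DirectSum.decompose M.deg (m : M.carrier)).support,
          (⟨M.component i m, hK i m.2⟩ : K) := by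
        refine Subtype.ext ?_
        rw [AddSubmonoidClass.coe_finsetSum]
        exact (DirectSum.sum_support_decompose M.deg (m : M.carrier)).symm
      rw [hm]
      exact sum_mem fun i _ => Submodule.mem_iSup_of_mem i (M.component_mem i m)
  smul_mem i j m r hm hr := M.smul_mem i j m r hm hr
  finite := Module.Finite.iff_fg.2 hfin

variable {M N : GrMod k 𝒜} {i : ℤ} {x : M.carrier}

lemma exists_component_orbit_eq (h𝒜 : ⨆ j, 𝒜 j = ⊤) (i a : ℤ) (r : A) :
    ∃ s : A, (∀ j : ℕ, a = i + j → s ∈ 𝒜 j) ∧ ((∀ j : ℕ, a ≠ i + j) → s = 0) ∧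
      ∀ (M : GrMod k 𝒜), ∀ x ∈ M.deg i, M.component a (M.orbit x r) = M.orbit x s := by
  have hr : r ∈ ⨆ j, 𝒜 j := h𝒜 ▸ Submodule.mem_top
  induction hr using Submodule.iSup_induction' with
  | mem l r hr =>
    rcases eq_or_ne (i + l) a with rfl | hla
    · refine ⟨r, fun j hj => ?_, fun h => absurd rfl (h l),
        fun M x hx => component_of_mem (orbit_map_le hx l ⟨r, hr, rfl⟩)⟩
      obtain rfl : l = j := by omega
      exact hr
    · refine ⟨0, fun _ _ => zero_mem _, fun _ => rfl, fun M x hx => ?_⟩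
      rw [component_of_mem_ne (orbit_map_le hx l ⟨r, hr, rfl⟩) hla, map_zero]
  | zero => exact ⟨0, fun _ _ => zero_mem _, fun _ => rfl, fun M x _ => by simp only [map_zero]⟩
  | add r r' _ _ hr hr' =>
    obtain ⟨s, hs, hs0, hsx⟩ := hr
    obtain ⟨s', hs', hs0', hsx'⟩ := hr'
    refine ⟨s + s', fun j hj => add_mem (hs j hj) (hs' j hj),
      fun h => by rw [hs0 h, hs0' h, add_zero], fun M x hx => ?_⟩
    rw [map_add, map_add, map_add, hsx M x hx, hsx' M x hx]

lemma isHomogeneous_span_singleton (h𝒜 : ⨆ j, 𝒜 j = ⊤) (hx : x ∈ M.deg i) :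
    (Submodule.span Aᵐᵒᵖ {x}).IsHomogeneous M.deg := by
  intro a m hm
  obtain ⟨r, rfl⟩ := Submodule.mem_span_singleton.1 hm
  obtain ⟨s, -, -, hs⟩ := exists_component_orbit_eq h𝒜 i a r.unop
  have hsx : M.orbit x s ∈ Submodule.span Aᵐᵒᵖ {x} :=
    Submodule.smul_mem _ _ (Submodule.mem_span_singleton_self x)
  rwa [← hs M x hx] at hsx

lemma ker_orbit_le_of_homogeneous (h𝒜 : ⨆ j, 𝒜 j = ⊤) (hx : x ∈ M.deg i) {y : N.carrier}
    (hy : y ∈ N.deg i) (h : ∀ j, ∀ r ∈ 𝒜 j, op r • x = 0 → op r • y = 0) :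
    LinearMap.ker (M.orbit x) ≤ LinearMap.ker (N.orbit y) := by
  intro r hr
  by_contra hry
  obtain ⟨a, ha⟩ := exists_component_ne_zero hry
  obtain ⟨s, hs, hs0, hsxy⟩ := exists_component_orbit_eq h𝒜 i a r
  rw [hsxy N y hy] at ha
  by_cases haj : ∃ j : ℕ, a = i + j
  · obtain ⟨j, rfl⟩ := haj
    refine ha (h j s (hs j rfl) ?_)
    rw [← orbit_apply, ← hsxy M x hx, LinearMap.mem_ker.1 hr, map_zero]
  · rw [hs0 (not_exists.1 haj), map_zero] at ha
    exact ha rfl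

lemma exists_hom_of_ker_orbit_le (h𝒜 : ⨆ j, 𝒜 j = ⊤) (hx : x ∈ M.deg i) {y : N.carrier}
    (hy : y ∈ N.deg i) (hxy : LinearMap.ker (M.orbit x) ≤ LinearMap.ker (N.orbit y)) :
    ∃ f : M.sub _ (isHomogeneous_span_singleton h𝒜 hx) (Submodule.fg_span_singleton x) ⟶ N,
      ∀ r hr, Hom.toLin f ⟨M.orbit x r, hr⟩ = N.orbit y r := by
  set φ := LinearPMap.mkSpanSingleton' (σ := RingHom.id Aᵐᵒᵖ) x y fun r hr => hxy (x := r.unop) hr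
  have hφ (r : A) (hr : M.orbit x r ∈ Submodule.span Aᵐᵒᵖ {x}) :
      φ.toFun ⟨M.orbit x r, hr⟩ = N.orbit y r := LinearPMap.mkSpanSingleton'_apply x y _ (op r) hr
  refine ⟨Hom.mk φ.toFun ?_, hφ⟩
  rintro a ⟨m, hm⟩ (hma : m ∈ M.deg a)
  obtain ⟨r, rfl⟩ := Submodule.mem_span_singleton.1 hm
  obtain ⟨s, -, -, hs⟩ := exists_component_orbit_eq h𝒜 i a r.unop
  have hrs : r.unop - s ∈ LinearMap.ker (M.orbit x) := by
    rw [LinearMap.mem_ker, map_sub, ← hs M x hx, sub_eq_zero]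
    exact (component_of_mem hma).symm
  have hrsy : N.orbit y r.unop = N.orbit y s := by
    rw [← sub_eq_zero, ← map_sub]
    exact hxy hrs
  have hφr : φ.toFun ⟨r • x, hm⟩ = N.component a (N.orbit y r.unop) :=
    (hφ r.unop hm).trans (hrsy.trans (hs N y hy).symm)
  exact hφr ▸ component_mem a _

variable [IsFGGrading 𝒜]

lemma isOneCritical_of_deg_le_span (hM : M.gkdim = 1)
    (hgen : ∀ i, ∀ x ∈ M.deg i, x ≠ 0 →
      ∃ L : ℤ, ∀ j ≥ L, M.deg j ≤ (Submodule.span Aᵐᵒᵖ {x}).restrictScalars k) :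
    M.IsOneCritical := by
  refine ⟨hM, fun P p hsurj hinj => ?_⟩
  obtain ⟨v, hv, hv0⟩ : ∃ v, Hom.toLin p v = 0 ∧ v ≠ 0 := by
    rw [injective_iff_map_eq_zero] at hinj
    push Not at hinj
    exact hinj
  obtain ⟨i, hi⟩ := exists_component_ne_zero hv0
  have hpi : Hom.toLin p (M.component i v) = 0 := by
    rw [← Hom.component_toLin, hv, map_zero]
  obtain ⟨L, hL⟩ := hgen i _ (M.component_mem i v) hi
  have hker : ∀ j ≥ L, ∀ m ∈ M.deg j, Hom.toLin p m = 0 := fun j hj m hm =>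
    (Submodule.span_le (p := LinearMap.ker (Hom.toLin p))).2 (Set.singleton_subset_iff.2 hpi)
      (hL j hj hm)
  refine gkdim_lt_one_of_deg_eq_bot (N := L) fun j hj => (Submodule.eq_bot_iff _).2 fun y hy => ?_
  obtain ⟨m, rfl⟩ := hsurj y
  rw [← component_of_mem hy, Hom.component_toLin, hker j hj _ (M.component_mem j m)]

namespace IsOneCritical

lemma exists_deg_le_span (hM : M.IsOneCritical) (hx : x ∈ M.deg i) (hx0 : x ≠ 0) :
    ∃ L : ℤ, ∀ j ≥ L, M.deg j ≤ (Submodule.span Aᵐᵒᵖ {x}).restrictScalars k := by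
  have hK := isHomogeneous_span_singleton IsFGGrading.iSup_eq_top hx
  have hquot : (M.quot _ hK).gkdim < 1 := by
    refine hM.2 _ (M.quotMk _ hK) (Submodule.mkQ_surjective _) fun hinj => hx0 (hinj ?_)
    rw [map_zero]
    exact (Submodule.Quotient.mk_eq_zero _).2 (Submodule.mem_span_singleton_self x)
  obtain ⟨L, hL⟩ := exists_deg_eq_bot_of_gkdim_lt_one hquot
  refine ⟨L, fun j hj m hm => ?_⟩
  have hm' : Submodule.Quotient.mk m ∈ (M.quot _ hK).deg j := ⟨m, hm, rfl⟩
  rw [hL j hj] at hm'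
  exact (Submodule.Quotient.mk_eq_zero _).1 ((Submodule.mem_bot k).1 hm')

lemma eventually_deg_eq_orbit_map (hM : M.IsOneCritical) (hx : x ∈ M.deg i) (hx0 : x ≠ 0) :
    ∀ᶠ j : ℕ in atTop, M.deg (i + j) = (𝒜 j).map (M.orbit x) := by
  obtain ⟨L, hL⟩ := hM.exists_deg_le_span hx hx0
  filter_upwards [eventually_ge_atTop (L - i).toNat] with j hj
  refine le_antisymm (fun m hm => ?_) (orbit_map_le hx j)
  obtain ⟨r, rfl⟩ := Submodule.mem_span_singleton.1 (hL _ (by omega) hm)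
  obtain ⟨s, hs, -, hsx⟩ := exists_component_orbit_eq (IsFGGrading.iSup_eq_top (𝒜 := 𝒜))
    i (i + j) r.unop
  exact ⟨s, hs j rfl, (hsx M x hx).symm.trans (component_of_mem hm)⟩

lemma exists_deg_ne_bot (hM : M.IsOneCritical) (L : ℤ) : ∃ j ≥ L, M.deg j ≠ ⊥ := by
  by_contra! h
  exact (gkdim_lt_one_of_deg_eq_bot h).ne hM.1

lemma torsion_eq_bot (hM : M.IsOneCritical) : M.torsion = ⊥ := by
  refine (Submodule.eq_bot_iff _).2 fun m hm => ?_
  by_contra hm0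
  obtain ⟨i, hi⟩ := exists_component_ne_zero hm0
  obtain ⟨s, hs⟩ := mem_torsion_iff.1 (component_mem_torsion hm i)
  obtain ⟨T, hT⟩ := eventually_atTop.1 (hM.eventually_deg_eq_orbit_map (M.component_mem i m) hi)
  obtain ⟨j, hj, hne⟩ := hM.exists_deg_ne_bot (i + (max s T : ℕ))
  obtain ⟨j, rfl⟩ : ∃ l : ℕ, j = i + l := ⟨(j - i).toNat, by omega⟩
  rw [hT j (by omega), Submodule.ne_bot_iff] at hne
  obtain ⟨_, ⟨r, hr, rfl⟩, hne⟩ := hne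
  exact hne (hs j (by omega) r hr)

lemma eventually_smul_eq_zero_of_qgrClass_eq (hM : M.IsOneCritical) (hN : N.IsOneCritical)
    (hMN : M.qgrClass = N.qgrClass) {l : Filter ℤ} (hl : l ≤ atTop) {z : A}
    (h : ∀ᶠ i in l, ∀ m ∈ M.deg i, op z • m = 0) : ∀ᶠ i in l, ∀ m ∈ N.deg i, op z • m = 0 := by
  have := eventually_smul_mem_torsion_of_qgrClass_eq hl hMN (z := z)
  simp only [hM.torsion_eq_bot, hN.torsion_eq_bot, Submodule.mem_bot] at this
  exact this h

lemma torsionIso_of_injective (hM : M.IsOneCritical) (hx : x ∈ M.deg i) (hx0 : x ≠ 0) {f : N ⟶ M}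
    (hf : Function.Injective (Hom.toLin f)) (hxf : x ∈ LinearMap.range (Hom.toLin f)) :
    torsionIso k 𝒜 f := by
  obtain ⟨L, hL⟩ := hM.exists_deg_le_span hx hx0
  have hspan : Submodule.span Aᵐᵒᵖ {x} ≤ LinearMap.range (Hom.toLin f) :=
    Submodule.span_le.2 (Set.singleton_subset_iff.2 hxf)
  refine ⟨fun m hm => ⟨0, fun j _ r _ => ?_⟩, fun m => ?_⟩
  · rw [(map_eq_zero_iff _ hf).1 hm, smul_zero]
  induction m using DirectSum.Decomposition.inductionOn M.deg with
  | zero => exact ⟨0, fun j _ r _ => by rw [smul_zero]; exact zero_mem _⟩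
  | @homogeneous a m =>
    exact ⟨(L - a).toNat, fun j hj r hr =>
      hspan (hL (a + j) (by omega) (M.smul_mem a j m r m.2 hr))⟩
  | add m m' hm hm' =>
    obtain ⟨s, hs⟩ := hm
    obtain ⟨s', hs'⟩ := hm'
    refine ⟨max s s', fun j hj r hr => ?_⟩
    rw [smul_add]
    exact add_mem (hs j (le_of_max_le_left hj) r hr) (hs' j (le_of_max_le_right hj) r hr)

theorem qgrClass_eq_of_ker_orbit_eq (hM : M.IsOneCritical) (hN : N.IsOneCritical)
    (hx : x ∈ M.deg i) (hx0 : x ≠ 0) {y : N.carrier} (hy : y ∈ N.deg i) (hy0 : y ≠ 0)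
    (hxy : LinearMap.ker (M.orbit x) = LinearMap.ker (N.orbit y)) : M.qgrClass = N.qgrClass := by
  have h𝒜 := IsFGGrading.iSup_eq_top (𝒜 := 𝒜)
  obtain ⟨f, hf⟩ := exists_hom_of_ker_orbit_le h𝒜 hx hx le_rfl
  obtain ⟨g, hg⟩ := exists_hom_of_ker_orbit_le h𝒜 hx hy hxy.le
  have hxmem : M.orbit x 1 ∈ Submodule.span Aᵐᵒᵖ {x} :=
    Submodule.smul_mem _ _ (Submodule.mem_span_singleton_self x)
  refine (torsionIso.qgrClass_eq (f := f) ?_).symm.trans (torsionIso.qgrClass_eq (f := g) ?_)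
  · refine hM.torsionIso_of_injective hx hx0 ((injective_iff_map_eq_zero _).2 ?_)
      ⟨⟨_, hxmem⟩, (hf 1 hxmem).trans (one_smul _ x)⟩
    rintro ⟨m, hm⟩ hfm
    obtain ⟨r, rfl⟩ := Submodule.mem_span_singleton.1 hm
    exact Subtype.ext ((hf r.unop hm).symm.trans hfm)
  · refine hN.torsionIso_of_injective hy hy0 ((injective_iff_map_eq_zero _).2 ?_)
      ⟨⟨_, hxmem⟩, (hg 1 hxmem).trans (one_smul _ y)⟩
    rintro ⟨m, hm⟩ hgm
    obtain ⟨r, rfl⟩ := Submodule.mem_span_singleton.1 hm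
    exact Subtype.ext (hxy.ge ((hg r.unop hm).symm.trans hgm) : r.unop ∈ _)

end IsOneCritical

end GrMod

end Critical

section Critical

variable {k : Type u} [Field k] {A : Type u} [Ring A] [Algebra k A] {𝒜 : ℕ → Submodule k A}

/-- `z` is a homogeneous normal element of degree `e`: left and right multiples of `z` agree, degree
by degree. -/
structure IsGradedNormal (𝒜 : ℕ → Submodule k A) (e : ℕ) (z : A) : Prop where
  mem : z ∈ 𝒜 e
  exists_mul_eq : ∀ j, ∀ r ∈ 𝒜 j, ∃ r' ∈ 𝒜 j, r * z = z * r'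
  exists_eq_mul : ∀ j, ∀ r ∈ 𝒜 j, ∃ r' ∈ 𝒜 j, z * r = r' * z

lemma IsGradedNormal.of_commute {e : ℕ} {z : A} (hz : z ∈ 𝒜 e) (hcomm : ∀ r, Commute z r) :
    IsGradedNormal 𝒜 e z :=
  ⟨hz, fun _ r hr => ⟨r, hr, (hcomm r).eq.symm⟩, fun _ r hr => ⟨r, hr, (hcomm r).eq⟩⟩

namespace GrMod

variable {M : GrMod k 𝒜}

lemma IsOneCritical.smul_eq_zero_or_isSMulRegular [IsFGGrading 𝒜] {e : ℕ} {z : A}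
    (hM : M.IsOneCritical) (hz : IsGradedNormal 𝒜 e z) :
    (∀ m : M.carrier, op z • m = 0) ∨ IsSMulRegular M.carrier (op z) := by
  refine or_iff_not_imp_right.2 fun hreg => ?_
  obtain ⟨v, hvz, hv⟩ : ∃ v : M.carrier, op z • v = 0 ∧ v ≠ 0 := by
    by_contra! h
    exact hreg fun x y hxy => sub_eq_zero.1 (h _ (by rw [smul_sub, sub_eq_zero]; exact hxy))
  obtain ⟨i, hvi⟩ := exists_component_ne_zero hv
  have hviz : op z • M.component i v = 0 := by rw [← component_smul hz.mem, hvz, map_zero]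
  obtain ⟨L, hL⟩ := eventually_atTop.1 (hM.eventually_deg_eq_orbit_map (M.component_mem i v) hvi)
  have hker (j : ℕ) (hj : j ≥ L) (m : M.carrier) (hm : m ∈ M.deg (i + j)) : op z • m = 0 := by
    rw [hL j hj] at hm
    obtain ⟨r, hr, rfl⟩ := hm
    obtain ⟨r', -, hrz⟩ := hz.exists_mul_eq j r hr
    rw [orbit_apply, smul_smul, ← op_mul, hrz, op_mul, mul_smul, hviz, smul_zero]
  intro m
  induction m using DirectSum.Decomposition.inductionOn M.deg with
  | zero => rw [smul_zero]
  | @homogeneous a m =>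
    rw [← Submodule.mem_bot k, ← hM.torsion_eq_bot, mem_torsion_iff]
    refine ⟨(i + L - a).toNat, fun j hj r hr => ?_⟩
    obtain ⟨r', hr', hzr⟩ := hz.exists_eq_mul j r hr
    rw [smul_smul, ← op_mul, hzr, op_mul, mul_smul]
    refine hker (a + j - i).toNat (by omega) _ ?_
    rw [show i + ((a + j - i).toNat : ℤ) = a + j by omega]
    exact M.smul_mem a j m r' m.2 hr'
  | add m m' hm hm' => rw [smul_add, hm, hm', add_zero]

lemma hilb_le_add_of_isSMulRegular [IsFGGrading 𝒜] {e : ℕ} {z : A} (hz : z ∈ 𝒜 e)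
    (hreg : IsSMulRegular M.carrier (op z)) (i : ℤ) : M.hilb i ≤ M.hilb (i + e) := by
  let φ : M.deg i →ₗ[k] M.deg (i + e) :=
    { toFun := fun m => ⟨op z • m.1, M.smul_mem i e m z m.2 hz⟩
      map_add' := fun x y => Subtype.ext (smul_add _ _ _)
      map_smul' := fun c x => Subtype.ext (smul_comm _ _ _) }
  exact LinearMap.finrank_le_finrank_of_injective (f := φ) fun x y hxy =>
    Subtype.ext (hreg (congrArg Subtype.val hxy))

end GrMod

lemma exists_add_eq_of_le_add_of_bounded {h : ℤ → ℕ} {D : ℕ} (hinc : ∀ i, h i ≤ h (i + D)) {B : ℕ}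
    (hB : ∀ i, h i ≤ B) : ∃ N : ℤ, ∀ i ≥ N, h (i + D) = h i := by
  set S : ℤ → ℕ := fun i => ∑ r ∈ Finset.range D, h (i + r)
  have hS (i : ℤ) : S (i + 1) + h i = S i + h (i + D) := by
    have hsucc := Finset.sum_range_succ (fun r : ℕ => h (i + r)) D
    have hsucc' := Finset.sum_range_succ' (fun r : ℕ => h (i + r)) D
    simp only [Nat.cast_add, Nat.cast_one, Nat.cast_zero, add_zero] at hsucc'
    simp only [S, ← hsucc, hsucc', add_right_comm i 1, ← add_assoc]
  have hmono : Monotone S := monotone_int_of_le_succ fun i => by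
    have := hS i
    have := hinc i
    omega
  obtain ⟨_, ⟨N, rfl⟩, hN⟩ := Set.exists_max_image (Set.range S) id
    ((Set.finite_le_nat (D * B)).subset (by
      rintro _ ⟨i, rfl⟩
      simpa using Finset.sum_le_card_nsmul (Finset.range D) _ B fun r _ => hB _))
    (Set.range_nonempty S)
  refine ⟨N, fun i hi => ?_⟩
  have hSi := hS i
  have h1 := hN _ ⟨i + 1, rfl⟩
  have h2 := hmono hi
  have h3 := hmono (show i ≤ i + 1 by omega)
  simp only [id] at h1
  omega

namespace GrMod

variable {M : GrMod k 𝒜}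

lemma eventually_hilb_le_sq (hM : M.gkdim = 1) :
    ∀ᶠ i : ℕ in atTop, (M.hilb i : ℝ) ≤ (i : ℝ) ^ 2 := by
  have hlt : M.gkdim < ((2 : ℝ) : EReal) := by
    rw [hM]
    exact_mod_cast one_lt_two
  filter_upwards [eventually_lt_of_limsup_lt hlt, eventually_ge_atTop 2] with i hi hi2
  rw [EReal.coe_lt_coe_iff, div_lt_iff₀ (Real.log_pos (by exact_mod_cast hi2))] at hi
  have hle : (M.hilb i : ℝ) ≤ ∑ j ∈ Finset.Icc (-(i : ℤ)) i, (M.hilb j : ℝ) :=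
    Finset.single_le_sum (f := fun j : ℤ => (M.hilb j : ℝ)) (fun _ _ => Nat.cast_nonneg _)
      (Finset.mem_Icc.2 ⟨by omega, le_rfl⟩)
  rcases (M.hilb i).eq_zero_or_pos with h0 | h0
  · rw [h0, Nat.cast_zero]
    positivity
  refine hle.trans
    ((Real.log_le_log_iff (hle.trans_lt' (by exact_mod_cast h0)) (by positivity)).1 ?_)
  rw [Real.log_pow]
  exact_mod_cast hi.le

lemma summable_hilb [IsFGGrading 𝒜] (hM : M.gkdim = 1) {t : ℝ} (ht0 : 0 < t) (ht1 : t < 1) :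
    Summable fun i : ℤ => (M.hilb i : ℝ) * t ^ i := by
  obtain ⟨N, hN⟩ := M.exists_lower_bound
  refine Summable.of_nat_of_neg ?_ ?_
  · have hs := summable_pow_mul_geometric_of_norm_lt_one 2 (r := t)
      (by rwa [Real.norm_of_nonneg ht0.le])
    refine Summable.of_norm_bounded_eventually_nat hs ?_
    filter_upwards [eventually_hilb_le_sq hM] with i hi
    rw [Real.norm_of_nonneg (by positivity), zpow_natCast]
    gcongr
  · refine summable_of_ne_finset_zero (s := Finset.range ((-N).toNat + 1)) fun i hi => ?_
    rw [Finset.mem_range] at hi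
    rw [hilb, hN _ (by omega), finrank_bot, Nat.cast_zero, zero_mul]

end GrMod

lemma tendsto_one_sub_div_one_sub_pow {D : ℕ} (hD : 0 < D) :
    Tendsto (fun t : ℝ => (1 - t) / (1 - t ^ D)) (𝓝[<] 1) (𝓝 (D : ℝ)⁻¹) := by
  have hc : Continuous fun t : ℝ => ∑ i ∈ Finset.range D, t ^ i := by fun_prop
  have hlim := (hc.tendsto 1).mono_left (nhdsWithin_le_nhds (s := Set.Iio 1))
  simp only [one_pow, Finset.sum_const, Finset.card_range, nsmul_eq_mul, mul_one] at hlim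
  refine (hlim.inv₀ (by positivity)).congr' ?_
  filter_upwards [self_mem_nhdsWithin] with t (ht : t < 1)
  rw [← geom_sum_mul_neg t D, div_mul_cancel_right₀ (sub_pos.2 ht).ne']

namespace GrMod

variable {M : GrMod k 𝒜}

lemma hilb_mul_div_le_tsum [IsFGGrading 𝒜] (hM : M.gkdim = 1) {D : ℕ} (hD : 0 < D)
    (hinc : ∀ i, M.hilb i ≤ M.hilb (i + D)) (i : ℤ) {t : ℝ} (ht0 : 0 < t) (ht1 : t < 1) :
    (M.hilb i : ℝ) * t ^ i * (1 - t ^ D)⁻¹ ≤ ∑' i : ℤ, (M.hilb i : ℝ) * t ^ i := by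
  have hinc' (s : ℕ) : M.hilb i ≤ M.hilb (i + D * s) := by
    induction s with
    | zero => simp
    | succ s ih =>
      refine ih.trans ((hinc _).trans_eq ?_)
      rw [add_assoc, Nat.cast_succ, mul_add_one]
  have hinj : Function.Injective fun s : ℕ => i + (D : ℤ) * s := fun s s' h => by
    have hD' : (D : ℤ) ≠ 0 := by exact_mod_cast hD.ne'
    exact_mod_cast mul_left_cancel₀ hD' (add_left_cancel h)
  have hgeom := (hasSum_geometric_of_lt_one (by positivity)
    (pow_lt_one₀ ht0.le ht1 hD.ne')).mul_left ((M.hilb i : ℝ) * t ^ i)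
  refine hasSum_le_inj _ hinj (fun c _ => by positivity) (fun s => ?_) hgeom
    (summable_hilb hM ht0 ht1).hasSum
  rw [zpow_add₀ ht0.ne', zpow_mul, zpow_natCast, zpow_natCast, ← mul_assoc]
  have := hinc' s
  gcongr

lemma HasMultiplicity.hilb_le [IsFGGrading 𝒜] {e : ℝ} (he : M.HasMultiplicity e) (hM : M.gkdim = 1)
    {D : ℕ} (hD : 0 < D) (hinc : ∀ i, M.hilb i ≤ M.hilb (i + D)) (i : ℤ) :
    (M.hilb i : ℝ) ≤ D * e := by
  have hlow : Tendsto (fun t : ℝ => (M.hilb i : ℝ) * t ^ i * ((1 - t) / (1 - t ^ D))) (𝓝[<] 1)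
      (𝓝 ((M.hilb i : ℝ) * 1 ^ i * (D : ℝ)⁻¹)) :=
    (((continuousAt_zpow₀ 1 i (Or.inl one_ne_zero)).tendsto.mono_left
      nhdsWithin_le_nhds).const_mul _).mul (tendsto_one_sub_div_one_sub_pow hD)
  have hle := le_of_tendsto_of_tendsto hlow he ?_
  · rwa [one_zpow, mul_one, mul_inv_le_iff₀ (by positivity), mul_comm] at hle
  filter_upwards [self_mem_nhdsWithin, nhdsWithin_le_nhds (lt_mem_nhds zero_lt_one)]
    with t (ht1 : t < 1) ht0
  calc (M.hilb i : ℝ) * t ^ i * ((1 - t) / (1 - t ^ D))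
      = (1 - t) * ((M.hilb i : ℝ) * t ^ i * (1 - t ^ D)⁻¹) := by ring
    _ ≤ _ := mul_le_mul_of_nonneg_left (hilb_mul_div_le_tsum hM hD hinc i ht0 ht1) (by linarith)

end GrMod

end Critical

/-! ### The algebra of a quantum weighted hypersurface -/

section Hypersurface

variable {k : Type u} [Field k] {n : ℕ} {w : Fin n → ℕ} {q : Fin n → Fin n → k}

lemma gen_mul_gen (i j : Fin n) :
    gen w q j * gen w q i = q j i • (gen w q i * gen w q j) := by
  have := RingQuot.mkAlgHom_rel k (Rel.comm (w := w) (q := q) i j)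
  simpa only [gen, map_mul, map_smul] using this

lemma sum_gen_pow : ∑ i, gen w q i ^ expo w i = 0 := by
  have := RingQuot.mkAlgHom_rel k (Rel.hyp (w := w) (q := q))
  simpa only [gen, map_sum, map_pow, map_zero] using this

lemma list_prod_mem_hypGrading (l : List (Fin n)) :
    (l.map (gen w q)).prod ∈ hypGrading w q (l.map w).sum :=
  Submodule.subset_span ⟨l, rfl, rfl⟩

lemma gen_mem_hypGrading (i : Fin n) : gen w q i ∈ hypGrading w q (w i) := by
  simpa only [List.map_cons, List.map_nil, List.prod_singleton, List.sum_singleton] using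
    list_prod_mem_hypGrading (w := w) (q := q) [i]

instance : SetLike.GradedMonoid (hypGrading w q) where
  one_mem := list_prod_mem_hypGrading []
  mul_mem i j r s hr hs := by
    have hle : hypGrading w q i * hypGrading w q j ≤ hypGrading w q (i + j) := by
      rw [hypGrading, hypGrading, Submodule.span_mul_span, Submodule.span_le]
      rintro _ ⟨_, ⟨l, rfl, rfl⟩, _, ⟨l', rfl, rfl⟩, rfl⟩
      refine Submodule.subset_span ⟨l ++ l', ?_, ?_⟩ <;>
      simp only [List.map_append, List.sum_append, List.prod_append]
    exact hle (Submodule.mul_mem_mul hr hs)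

lemma hypGrading_le {U : ℕ → Submodule k (HypAlg w q)} (one : 1 ∈ U 0)
    (mul_gen : ∀ t i, ∀ r ∈ U t, r * gen w q i ∈ U (t + w i)) (t : ℕ) : hypGrading w q t ≤ U t := by
  refine Submodule.span_le.2 ?_
  rintro _ ⟨l, rfl, rfl⟩
  induction l using List.reverseRecOn with
  | nil => exact one
  | append_singleton l i ih =>
    simp only [List.map_append, List.map_cons, List.map_nil, List.sum_append, List.prod_append,
      List.sum_singleton, List.prod_singleton]
    exact mul_gen _ i _ ih

lemma iSup_hypGrading : ⨆ t, hypGrading w q t = ⊤ := by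
  have hadjoin : Algebra.adjoin k (Set.range (gen w q)) = ⊤ := by
    have hrange : Set.range (gen w q) =
        RingQuot.mkAlgHom k (Rel w q) '' Set.range (FreeAlgebra.ι k) := (Set.range_comp _ _)
    rw [hrange, ← AlgHom.map_adjoin, FreeAlgebra.adjoin_range_ι, Algebra.map_top,
      AlgHom.range_eq_top]
    exact RingQuot.mkAlgHom_surjective k _
  rw [eq_top_iff, ← Algebra.top_toSubmodule, ← hadjoin, Algebra.adjoin_eq_span, Submodule.span_le]
  intro r hr
  obtain ⟨t, ht⟩ : ∃ t, r ∈ hypGrading w q t := by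
    induction hr using Submonoid.closure_induction_right with
    | one => exact ⟨0, SetLike.GradedOne.one_mem⟩
    | mul_right r _ s hs ih =>
      obtain ⟨i, rfl⟩ := hs
      obtain ⟨t, ht⟩ := ih
      exact ⟨t + w i, SetLike.mul_mem_graded ht (gen_mem_hypGrading i)⟩
  exact Submodule.mem_iSup_of_mem t ht

lemma isFGGrading_hypGrading (hw : ∀ i, 0 < w i) : IsFGGrading (hypGrading w q) where
  iSup_eq_top := iSup_hypGrading
  finiteDimensional t := by
    refine FiniteDimensional.span_of_finite k (((List.finite_length_le (Fin n) t).image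
      fun l => (l.map (gen w q)).prod).subset ?_)
    rintro _ ⟨l, rfl, rfl⟩
    refine ⟨l, ?_, rfl⟩
    simpa using (l.map w).length_le_sum_of_one_le
      (by simpa using fun i _ => Nat.one_le_iff_ne_zero.2 (hw i).ne')
  exists_bound := by
    refine ⟨∑ i, w i, fun t ht => Submodule.span_le.2 ?_⟩
    rintro _ ⟨l, rfl, rfl⟩
    rcases l.eq_nil_or_concat with rfl | ⟨l, i, rfl⟩
    · simp at ht
    simp only [List.concat_eq_append, List.map_append, List.map_cons, List.map_nil,
      List.sum_append, List.prod_append, List.sum_singleton, List.prod_singleton]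
    refine SetLike.le_def.1 (le_iSup₂_of_le (w i) ?_ le_rfl)
      (Submodule.mul_mem_mul ?_ (gen_mem_hypGrading i))
    · exact Finset.mem_Icc.2 ⟨hw i, Finset.single_le_sum (fun _ _ => Nat.zero_le _)
        (Finset.mem_univ i)⟩
    · rw [Nat.add_sub_cancel]
      exact list_prod_mem_hypGrading l

lemma isGradedNormal_gen (i : Fin n) :
    IsGradedNormal (hypGrading w q) (w i) (gen w q i) where
  mem := gen_mem_hypGrading i
  exists_mul_eq t r hr := by
    obtain ⟨-, r', hr', h⟩ := hypGrading_le
      (U := fun t => hypGrading w q t ⊓ ((hypGrading w q t).map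
        (LinearMap.mulLeft k (gen w q i))).comap (LinearMap.mulRight k (gen w q i)))
      ⟨SetLike.GradedOne.one_mem, 1, SetLike.GradedOne.one_mem, Commute.one_right _⟩
      (fun t j r hr => by
        obtain ⟨hr, r', hr', h : gen w q i * r' = r * gen w q i⟩ := hr
        refine ⟨SetLike.mul_mem_graded hr (gen_mem_hypGrading j), q j i • (r' * gen w q j),
          Submodule.smul_mem _ _ (SetLike.mul_mem_graded hr' (gen_mem_hypGrading j)), ?_⟩
        simp only [LinearMap.mulLeft_apply, LinearMap.mulRight_apply]
        rw [mul_assoc r, gen_mul_gen, mul_smul_comm, mul_smul_comm, ← mul_assoc, h, mul_assoc])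
      t hr
    exact ⟨r', hr', h.symm⟩
  exists_eq_mul t r hr := by
    obtain ⟨-, r', hr', h⟩ := hypGrading_le
      (U := fun t => hypGrading w q t ⊓ ((hypGrading w q t).map
        (LinearMap.mulRight k (gen w q i))).comap (LinearMap.mulLeft k (gen w q i)))
      ⟨SetLike.GradedOne.one_mem, 1, SetLike.GradedOne.one_mem, Commute.one_left _⟩
      (fun t j r hr => by
        obtain ⟨hr, r', hr', h : r' * gen w q i = gen w q i * r⟩ := hr
        refine ⟨SetLike.mul_mem_graded hr (gen_mem_hypGrading j), q i j • (r' * gen w q j),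
          Submodule.smul_mem _ _ (SetLike.mul_mem_graded hr' (gen_mem_hypGrading j)), ?_⟩
        simp only [LinearMap.mulLeft_apply, LinearMap.mulRight_apply]
        rw [← mul_assoc, ← h, smul_mul_assoc, mul_assoc, mul_assoc, gen_mul_gen j i, mul_smul_comm])
      t hr
    exact ⟨r', hr', h.symm⟩

namespace GrMod

variable {M : GrMod k (hypGrading w q)} {i j : Fin n}

lemma gen_smul_comm (i j : Fin n) (m : M.carrier) :
    op (gen w q i) • op (gen w q j) • m = q j i • op (gen w q j) • op (gen w q i) • m := by
  rw [smul_smul, ← op_mul, gen_mul_gen i j, op_smul, op_mul, smul_assoc, mul_smul]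

lemma sum_gen_pow_smul (m : M.carrier) : ∑ i, op (gen w q i) ^ expo w i • m = 0 := by
  have h : (opAddEquiv : HypAlg w q ≃+ _) (∑ i, gen w q i ^ expo w i) = 0 := by
    rw [sum_gen_pow, map_zero]
  simp only [map_sum, opAddEquiv_apply, op_pow] at h
  rw [← Finset.sum_smul, h, zero_smul]

lemma gen_pow_smul_mem {a : ℤ} {m : M.carrier} (hm : m ∈ M.deg a) (i : Fin n) (e : ℕ) :
    op (gen w q i) ^ e • m ∈ M.deg (a + (e * w i : ℕ)) := by
  rw [← op_pow, ← smul_eq_mul]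
  exact M.smul_mem a _ m _ hm (SetLike.pow_mem_graded e (gen_mem_hypGrading i))

end GrMod

variable (w q) in
/-- The standing hypotheses on the weights `w i` and the commutation parameters `q i j`. -/
class IsAdmissible : Prop where
  weight_pos (i : Fin n) : 0 < w i
  weight_dvd (i : Fin n) : w i ∣ ∑ j, w j
  param_self (i : Fin n) : q i i = 1
  param_mul_param (i j : Fin n) : q i j * q j i = 1
  param_pow_left (i j : Fin n) : q i j ^ expo w i = 1
  param_pow_right (i j : Fin n) : q i j ^ expo w j = 1

namespace IsAdmissible

variable [IsAdmissible w q]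

instance : IsFGGrading (hypGrading w q) := isFGGrading_hypGrading (weight_pos q)

variable (q) in
include q in
lemma expo_mul_weight (i : Fin n) : expo w i * w i = ∑ j, w j :=
  Nat.div_mul_cancel (weight_dvd q i)

variable (q) in
include q in
lemma sum_weight_pos (i : Fin n) : 0 < ∑ j, w j :=
  (weight_pos q i).trans_le (Finset.single_le_sum (fun _ _ => Nat.zero_le _) (Finset.mem_univ i))

variable (q) in
include q in
lemma expo_pos (i : Fin n) : 0 < expo w i :=
  Nat.div_pos (Nat.le_of_dvd (sum_weight_pos q i) (weight_dvd q i)) (weight_pos q i)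

lemma gen_pow_expo_smul_eq_zero {M : GrMod k (hypGrading w q)} {i : Fin n}
    (hi : ∀ m : M.carrier, op (gen w q i) • m = 0) (m : M.carrier) :
    op (gen w q i) ^ expo w i • m = 0 := by
  rw [← Nat.sub_add_cancel (expo_pos q i), pow_succ, mul_smul, hi, smul_zero]

end IsAdmissible

end Hypersurface

/-! ### Modules over a quantum plane -/

section QuantumPlane

variable {k R V : Type*} [CommRing k] [Ring R] [Algebra k R] [AddCommGroup V] [Module k V]
  [Module R V] [IsScalarTower k R V]

lemma pow_mul_of_mul_eq_smul {x y : R} {p : k} (h : x * y = p • (y * x)) (a : ℕ) :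
    x ^ a * y = p ^ a • (y * x ^ a) := by
  induction a with
  | zero => simp only [pow_zero, one_mul, mul_one, one_smul]
  | succ a ih =>
    rw [pow_succ, mul_assoc, h, mul_smul_comm, ← mul_assoc, ih, smul_mul_assoc, smul_smul,
      ← pow_succ', mul_assoc]

lemma pow_mul_pow_of_mul_eq_smul {x y : R} {p : k} (h : x * y = p • (y * x)) (a b : ℕ) :
    x ^ a * y ^ b = p ^ (a * b) • (y ^ b * x ^ a) := by
  induction b with
  | zero => simp only [pow_zero, mul_zero, one_mul, mul_one, one_smul]
  | succ b ih =>
    rw [pow_succ, ← mul_assoc, ih, smul_mul_assoc, mul_assoc, pow_mul_of_mul_eq_smul h,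
      mul_smul_comm, smul_smul, ← pow_add, mul_add_one, mul_assoc]

lemma pow_smul_eq_of_smul_eq {x y : R} {p ν : k} (h : y * x = p • (x * y)) {v : V}
    (hv : y • v = ν • x • v) (s : ℕ) : y ^ s • v = (ν ^ s * p ^ s.choose 2) • x ^ s • v := by
  have hcomm (s : ℕ) : y * x ^ s = p ^ s • (x ^ s * y) := by
    simpa only [pow_one, one_mul] using pow_mul_pow_of_mul_eq_smul h 1 s
  induction s with
  | zero => simp only [pow_zero, one_mul, Nat.choose_zero_succ, one_smul]
  | succ s ih =>
    calc y ^ (s + 1) • v = (ν ^ s * p ^ s.choose 2) • (y * x ^ s) • v := by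
          rw [pow_succ', mul_smul, ih, smul_comm y, mul_smul y]
      _ = (ν ^ s * p ^ s.choose 2 * p ^ s * ν) • x ^ (s + 1) • v := by
          rw [hcomm, smul_assoc, mul_smul (x ^ s), hv, smul_comm (x ^ s) ν, smul_smul, smul_smul,
            pow_succ, mul_smul (x ^ s)]
      _ = (ν ^ (s + 1) * p ^ (s + 1).choose 2) • x ^ (s + 1) • v := by
          rw [Nat.choose_succ_succ', Nat.choose_one_right]
          congr 1
          ring

end QuantumPlane

section Edge

variable {n : ℕ} (w : Fin n → ℕ)

/-- The exponent `e` for which `x_i ^ e` has degree `lcm (w i) (w j)`. -/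
def lcmExp (i j : Fin n) : ℕ := (w i).lcm (w j) / w i

/-- The number of powers of `x_i ^ lcmExp w i j` that make up `x_i ^ expo w i`. It is symmetric in
`i` and `j`. -/
def edgeLength (i j : Fin n) : ℕ := (∑ l, w l) / (w i).lcm (w j)

variable {w}

lemma lcmExp_mul_weight (i j : Fin n) : lcmExp w i j * w i = (w i).lcm (w j) :=
  Nat.div_mul_cancel (Nat.dvd_lcm_left _ _)

lemma lcmExp_pos {i : Fin n} (hi : 0 < w i) {j : Fin n} (hj : 0 < w j) : 0 < lcmExp w i j :=
  Nat.div_pos (Nat.le_of_dvd (Nat.lcm_pos hi hj) (Nat.dvd_lcm_left _ _)) hi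

lemma edgeLength_comm (i j : Fin n) : edgeLength w i j = edgeLength w j i := by
  rw [edgeLength, edgeLength, Nat.lcm_comm]

lemma gcd_mul_lcmExp {i : Fin n} (hi : 0 < w i) (j : Fin n) :
    (w i).gcd (w j) * lcmExp w i j = w j := by
  refine Nat.eq_of_mul_eq_mul_left hi ?_
  calc w i * ((w i).gcd (w j) * lcmExp w i j)
      = (w i).gcd (w j) * (lcmExp w i j * w i) := by ring
    _ = w i * w j := by rw [lcmExp_mul_weight, Nat.gcd_mul_lcm]

lemma coprime_lcmExp {i j : Fin n} (hi : 0 < w i) (hj : 0 < w j) :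
    (lcmExp w i j).Coprime (lcmExp w j i) := by
  refine Nat.eq_of_mul_eq_mul_left (Nat.gcd_pos_of_pos_left (w j) hi) ?_
  rw [← Nat.gcd_mul_left, gcd_mul_lcmExp hi, Nat.gcd_comm (w i), gcd_mul_lcmExp hj, mul_one]

lemma exists_eq_add_lcmExp {i j : Fin n} (hi : 0 < w i) (hj : 0 < w j) {a b a' b' : ℕ}
    (h : a * w i + b * w j = a' * w i + b' * w j) (hle : a ≤ a') :
    ∃ s, a' = a + s * lcmExp w i j ∧ b = b' + s * lcmExp w j i := by
  obtain ⟨c, rfl⟩ := Nat.exists_eq_add_of_le hle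
  have hb : b' ≤ b := by
    refine le_of_mul_le_mul_right ?_ hj
    rw [add_mul] at h
    omega
  obtain ⟨e, rfl⟩ := Nat.exists_eq_add_of_le hb
  have hce : e * w j = c * w i := by linarith
  obtain ⟨s, hs⟩ := Nat.lcm_dvd (Dvd.intro_left c rfl) (hce ▸ Dvd.intro_left e rfl)
  refine ⟨s, congrArg _ (Nat.eq_of_mul_eq_mul_right hi ?_),
    congrArg _ (Nat.eq_of_mul_eq_mul_right hj ?_)⟩
  · rw [mul_assoc, lcmExp_mul_weight, hs, mul_comm]
  · rw [mul_assoc, lcmExp_mul_weight, Nat.lcm_comm, hce, hs, mul_comm]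

variable {k : Type*} [Field k] {q : Fin n → Fin n → k} [IsAdmissible w q]

namespace IsAdmissible

variable (q)

include q

lemma lcm_dvd_sum (i j : Fin n) : (w i).lcm (w j) ∣ ∑ l, w l :=
  Nat.lcm_dvd (weight_dvd q i) (weight_dvd q j)

lemma lcmExp_mul_edgeLength (i j : Fin n) : lcmExp w i j * edgeLength w i j = expo w i := by
  refine Nat.eq_of_mul_eq_mul_right (weight_pos q i : 0 < w i) ?_
  rw [mul_right_comm, lcmExp_mul_weight, expo_mul_weight q i, edgeLength,
    Nat.mul_div_cancel' (lcm_dvd_sum q i j)]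

lemma edgeLength_pos (i j : Fin n) : 0 < edgeLength w i j :=
  Nat.pos_of_ne_zero <| right_ne_zero_of_mul <|
    (lcmExp_mul_edgeLength q i j).trans_ne (expo_pos q i : 0 < expo w i).ne'

variable {q}

lemma param_pow_edgeLength (i j : Fin n) : q i j ^ edgeLength w i j = 1 := by
  have hpow {e : ℕ} (he : q i j ^ (e * edgeLength w i j) = 1) :
      (q i j ^ edgeLength w i j) ^ e = 1 := by
    rw [← pow_mul, mul_comm, he]
  have hi : (q i j ^ edgeLength w i j) ^ lcmExp w i j = 1 :=
    hpow (by rw [lcmExp_mul_edgeLength q i, param_pow_left])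
  have hj : (q i j ^ edgeLength w i j) ^ lcmExp w j i = 1 :=
    hpow (by rw [edgeLength_comm, lcmExp_mul_edgeLength q j, param_pow_right])
  have hcop : (lcmExp w i j).gcd (lcmExp w j i) = 1 :=
    coprime_lcmExp (weight_pos q i) (weight_pos q j)
  rw [← pow_one (q i j ^ _), ← hcop]
  exact pow_gcd_eq_one.2 ⟨hi, hj⟩

variable (w) in
include w in
lemma param_ne_zero (i j : Fin n) : q i j ≠ 0 :=
  left_ne_zero_of_mul_eq_one (param_mul_param w i j)

end IsAdmissible

end Edge

section SlopeVector

variable {k : Type u} [Field k] {n : ℕ} {w : Fin n → ℕ} {q : Fin n → Fin n → k}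
  {V : Type*} [AddCommGroup V] [Module k V] [Module (HypAlg w q)ᵐᵒᵖ V]
  [IsScalarTower k (HypAlg w q)ᵐᵒᵖ V] {i j : Fin n} {ν : k} {v : V}

variable (w q) in
/-- The action of `x_i ^ a * x_j ^ b` on right modules. -/
def edgeMonomial (i j : Fin n) (a b : ℕ) : (HypAlg w q)ᵐᵒᵖ :=
  op (gen w q j) ^ b * op (gen w q i) ^ a

variable (w q) in
/-- The action on right modules of the power of `x_i` of degree `lcm (w i) (w j)`. -/
def edgeGen (i j : Fin n) : (HypAlg w q)ᵐᵒᵖ := op (gen w q i) ^ lcmExp w i j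

variable (w q) in
/-- The commutation parameter of `edgeGen w q j i` and `edgeGen w q i j`. -/
def edgeParam (i j : Fin n) : k := q i j ^ (lcmExp w j i * lcmExp w i j)

lemma op_gen_mul_op_gen (i j : Fin n) :
    op (gen w q j) * op (gen w q i) = q i j • (op (gen w q i) * op (gen w q j)) := by
  rw [← op_mul, ← op_mul, gen_mul_gen j i, op_smul]

lemma edgeGen_mul_edgeGen (i j : Fin n) : edgeGen w q j i * edgeGen w q i j =
    edgeParam w q i j • (edgeGen w q i j * edgeGen w q j i) :=
  pow_mul_pow_of_mul_eq_smul (op_gen_mul_op_gen i j) _ _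

lemma op_smul_mem_span_edgeMonomial
    (hV : ∀ l, l ≠ i → l ≠ j → ∀ u : V, op (gen w q l) • u = 0) (v : V) {t : ℕ} {r : HypAlg w q}
    (hr : r ∈ hypGrading w q t) : op r • v ∈ Submodule.span k
      {y | ∃ a b, a * w i + b * w j = t ∧ y = edgeMonomial w q i j a b • v} := by
  set S : ℕ → Submodule k V := fun t => Submodule.span k
    {y | ∃ a b, a * w i + b * w j = t ∧ y = edgeMonomial w q i j a b • v}
  have hS (t : ℕ) (l : Fin n) (y : V) (hy : y ∈ S t) : op (gen w q l) • y ∈ S (t + w l) := by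
    refine (Submodule.span_le (p := (S (t + w l)).comap
      (Module.toModuleEnd k (S := (HypAlg w q)ᵐᵒᵖ) V (op (gen w q l))))).2 ?_ hy
    rintro _ ⟨a, b, rfl, rfl⟩
    change op (gen w q l) • edgeMonomial w q i j a b • v ∈ S (a * w i + b * w j + w l)
    by_cases hlj : l = j
    · subst hlj
      refine Submodule.subset_span ⟨a, b + 1, by ring, ?_⟩
      rw [edgeMonomial, edgeMonomial, pow_succ', smul_smul, mul_assoc]
    by_cases hli : l = i
    · subst hli
      have hcomm := pow_mul_pow_of_mul_eq_smul (op_gen_mul_op_gen (w := w) (q := q) j l) 1 b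
      rw [pow_one] at hcomm
      rw [edgeMonomial, smul_smul, ← mul_assoc, hcomm, smul_mul_assoc, mul_assoc, ← pow_succ',
        smul_assoc]
      exact Submodule.smul_mem _ _ (Submodule.subset_span ⟨a + 1, b, by ring, rfl⟩)
    · rw [hV l hli hlj]
      exact zero_mem _
  refine hypGrading_le (U := fun t => (S t).comap
    ((LinearMap.toSpanSingleton (HypAlg w q)ᵐᵒᵖ V v).restrictScalars k ∘ₗ
      (opLinearEquiv k : HypAlg w q ≃ₗ[k] _).toLinearMap)) ?_ ?_ t hr
  · exact Submodule.subset_span ⟨0, 0, by simp only [zero_mul, add_zero],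
      by simp [edgeMonomial]⟩
  · intro t l r hr
    change op (r * gen w q l) • v ∈ S (t + w l)
    rw [op_mul, mul_smul]
    exact hS t l _ hr

lemma exists_edgeMonomial_smul_eq_of_le (hi : 0 < w i) (hj : 0 < w j) (hq : q i j ≠ 0)
    (hν : ν ≠ 0) (hv : edgeGen w q j i • v = ν • edgeGen w q i j • v) {a b a' b' : ℕ}
    (h : a * w i + b * w j = a' * w i + b' * w j) (hle : a ≤ a') :
    ∃ c : k, c ≠ 0 ∧ edgeMonomial w q i j a b • v = c • edgeMonomial w q i j a' b' • v := by
  obtain ⟨s, rfl, rfl⟩ := exists_eq_add_lcmExp hi hj h hle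
  have hpow := pow_smul_eq_of_smul_eq (edgeGen_mul_edgeGen i j) hv s
  rw [edgeGen, edgeGen, ← pow_mul', ← pow_mul'] at hpow
  refine ⟨q i j ^ (s * lcmExp w j i * a) * (ν ^ s * edgeParam w q i j ^ s.choose 2),
    mul_ne_zero (pow_ne_zero _ hq) (mul_ne_zero (pow_ne_zero _ hν)
      (pow_ne_zero _ (pow_ne_zero _ hq))), ?_⟩
  rw [edgeMonomial, pow_add, mul_assoc, pow_mul_pow_of_mul_eq_smul (op_gen_mul_op_gen i j),
    mul_smul_comm, smul_assoc, ← mul_assoc, mul_smul, hpow, smul_comm (_ ^ b' * _), smul_smul,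
    smul_smul, edgeMonomial, pow_add, mul_assoc (_ ^ b')]

lemma exists_edgeMonomial_smul_eq (hi : 0 < w i) (hj : 0 < w j) (hq : q i j ≠ 0)
    (hν : ν ≠ 0) (hv : edgeGen w q j i • v = ν • edgeGen w q i j • v) {a b a' b' : ℕ}
    (h : a * w i + b * w j = a' * w i + b' * w j) :
    ∃ c : k, edgeMonomial w q i j a b • v = c • edgeMonomial w q i j a' b' • v := by
  rcases le_total a a' with hle | hle
  · obtain ⟨c, -, hc⟩ := exists_edgeMonomial_smul_eq_of_le hi hj hq hν hv h hle
    exact ⟨c, hc⟩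
  · obtain ⟨c, hc0, hc⟩ := exists_edgeMonomial_smul_eq_of_le hi hj hq hν hv h.symm hle
    exact ⟨c⁻¹, by rw [hc, inv_smul_smul₀ hc0]⟩

lemma exists_op_smul_eq_edgeMonomial_smul
    (hV : ∀ l, l ≠ i → l ≠ j → ∀ u : V, op (gen w q l) • u = 0) (hi : 0 < w i) (hj : 0 < w j)
    (hq : q i j ≠ 0) (hν : ν ≠ 0) (hv : edgeGen w q j i • v = ν • edgeGen w q i j • v)
    {a b : ℕ} {r : HypAlg w q} (hr : r ∈ hypGrading w q (a * w i + b * w j)) :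
    ∃ c : k, op r • v = c • edgeMonomial w q i j a b • v := by
  have hspan : op r • v ∈ Submodule.span k {edgeMonomial w q i j a b • v} := by
    refine Submodule.span_le.2 ?_ (op_smul_mem_span_edgeMonomial hV v hr)
    rintro _ ⟨a', b', h, rfl⟩
    obtain ⟨c, hc⟩ := exists_edgeMonomial_smul_eq hi hj hq hν hv h
    exact Submodule.mem_span_singleton.2 ⟨c, hc.symm⟩
  obtain ⟨c, hc⟩ := Submodule.mem_span_singleton.1 hspan
  exact ⟨c, hc.symm⟩

lemma op_smul_eq_zero_of_forall_ne (hV : ∀ l, l ≠ i → l ≠ j → ∀ u : V, op (gen w q l) • u = 0)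
    {t : ℕ} (ht : ∀ a b, a * w i + b * w j ≠ t) {r : HypAlg w q} (hr : r ∈ hypGrading w q t)
    (v : V) : op r • v = 0 := by
  refine (Submodule.mem_bot k).1 (Submodule.span_le.2 ?_ (op_smul_mem_span_edgeMonomial hV v hr))
  rintro _ ⟨a, b, h, -⟩
  exact absurd h (ht a b)

end SlopeVector

/-! ### Active generators -/

section Active

variable {k : Type u} [Field k] {n : ℕ} {w : Fin n → ℕ} {q : Fin n → Fin n → k}

namespace GrMod

variable {M N : GrMod k (hypGrading w q)} {i j : Fin n}

/-- The generators that act injectively. On a `1`-critical module every other generator acts as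
zero. -/
def active (M : GrMod k (hypGrading w q)) : Set (Fin n) :=
  {i | IsSMulRegular M.carrier (op (gen w q i))}

lemma isSMulRegular_edgeGen (hi : i ∈ M.active) (j : Fin n) :
    IsSMulRegular M.carrier (edgeGen w q i j) :=
  IsSMulRegular.pow _ hi

lemma isSMulRegular_edgeMonomial (hi : i ∈ M.active) (hj : j ∈ M.active) (a b : ℕ) :
    IsSMulRegular M.carrier (edgeMonomial w q i j a b) :=
  (IsSMulRegular.pow b hj).mul (IsSMulRegular.pow a hi)

lemma edgeMonomial_smul_mem {c : ℤ} {m : M.carrier} (hm : m ∈ M.deg c) (i j : Fin n) (a b : ℕ) :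
    edgeMonomial w q i j a b • m ∈ M.deg (c + (a * w i + b * w j : ℕ)) := by
  rw [edgeMonomial, mul_smul, Nat.cast_add, ← add_assoc]
  exact gen_pow_smul_mem (gen_pow_smul_mem hm i a) j b

lemma exists_edgeMonomial_smul_mem (hi : i ∈ M.active) (hj : j ∈ M.active) {a b : ℤ}
    (hab : a ≡ b [ZMOD (w i).gcd (w j)]) (hle : a + ((w i).pred * (w j).pred : ℕ) ≤ b)
    {x : M.carrier} (hx : x ∈ M.deg a) (hx0 : x ≠ 0) :
    ∃ u v, edgeMonomial w q i j u v • x ∈ M.deg b ∧ edgeMonomial w q i j u v • x ≠ 0 := by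
  obtain ⟨t, rfl⟩ := Int.le.dest ((Int.le_add_of_nonneg_right (Int.natCast_nonneg _)).trans hle)
  have hdvd : (w i).gcd (w j) ∣ t :=
    Int.natCast_dvd_natCast.1 (add_sub_cancel_left a (t : ℤ) ▸ Int.modEq_iff_dvd.1 hab)
  obtain ⟨u, v, rfl⟩ :=
    Nat.exists_add_mul_eq_of_gcd_dvd_of_mul_pred_le (w i) (w j) t hdvd (by omega)
  exact ⟨u, v, edgeMonomial_smul_mem hx i j u v, fun h =>
    hx0 ((isSMulRegular_edgeMonomial hi hj u v).right_eq_zero_of_smul h)⟩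

namespace IsOneCritical

variable [IsAdmissible w q]

lemma smul_eq_zero_of_notMem_active (hM : M.IsOneCritical) (hi : i ∉ M.active) (m : M.carrier) :
    op (gen w q i) • m = 0 :=
  (hM.smul_eq_zero_or_isSMulRegular (isGradedNormal_gen i)).resolve_right hi m

lemma notMem_active_of_qgrClass_eq (hM : M.IsOneCritical) (hN : N.IsOneCritical)
    (hMN : M.qgrClass = N.qgrClass) (hi : i ∉ M.active) : i ∉ N.active := by
  intro hiN
  obtain ⟨L, hL⟩ := eventually_atTop.1 (hM.eventually_smul_eq_zero_of_qgrClass_eq hN hMN le_rfl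
    (.of_forall fun a m _ => hM.smul_eq_zero_of_notMem_active hi m))
  obtain ⟨a, ha, hne⟩ := hN.exists_deg_ne_bot L
  obtain ⟨m, hm, hm0⟩ := (Submodule.ne_bot_iff _).1 hne
  exact hm0 (hiN.right_eq_zero_of_smul (hL a ha m hm))

lemma active_eq_of_qgrClass_eq (hM : M.IsOneCritical) (hN : N.IsOneCritical)
    (hMN : M.qgrClass = N.qgrClass) : M.active = N.active :=
  Set.ext fun _ => not_iff_not.1 ⟨hM.notMem_active_of_qgrClass_eq hN hMN,
    hN.notMem_active_of_qgrClass_eq hM hMN.symm⟩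

lemma active_nonempty (hM : M.IsOneCritical) : M.active.Nonempty := by
  by_contra! hempty
  obtain ⟨a, -, hne⟩ := hM.exists_deg_ne_bot 0
  obtain ⟨m, -, hm0⟩ := (Submodule.ne_bot_iff _).1 hne
  have hker (t : ℕ) : hypGrading w q t ≤ if t = 0 then ⊤ else LinearMap.ker (M.orbit m) := by
    refine hypGrading_le (U := fun t => if t = 0 then ⊤ else LinearMap.ker (M.orbit m))
      Submodule.mem_top (fun t i r _ => ?_) t
    have hi : t + w i ≠ 0 := Nat.ne_of_gt (Nat.add_pos_right t (IsAdmissible.weight_pos q i))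
    rw [if_neg hi, LinearMap.mem_ker, orbit_apply, op_mul, mul_smul,
      hM.smul_eq_zero_of_notMem_active (hempty ▸ Set.notMem_empty i)]
  have htors : m ∈ M.torsion := mem_torsion_iff.2 ⟨1, fun t ht r hr => by
    have hr := hker t hr
    rwa [if_neg (Nat.one_le_iff_ne_zero.1 ht)] at hr⟩
  rw [hM.torsion_eq_bot] at htors
  exact hm0 htors

lemma active_nontrivial (hM : M.IsOneCritical) : M.active.Nontrivial := by
  obtain ⟨i, hi⟩ := hM.active_nonempty
  by_contra hsub
  have hi' : ∀ j, j ≠ i → j ∉ M.active := fun j hji hj =>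
    hji (Set.not_nontrivial_iff.1 hsub hj hi)
  obtain ⟨a, -, hne⟩ := hM.exists_deg_ne_bot 0
  obtain ⟨m, -, hm0⟩ := (Submodule.ne_bot_iff _).1 hne
  have hsum := M.sum_gen_pow_smul m
  rw [Fintype.sum_eq_single i fun j hji => ?_] at hsum
  · exact hm0 ((IsSMulRegular.pow _ hi).right_eq_zero_of_smul hsum)
  · exact IsAdmissible.gen_pow_expo_smul_eq_zero (hM.smul_eq_zero_of_notMem_active (hi' j hji)) m

end IsOneCritical

end GrMod

end Active

/-! ### Modules with two active generators -/

section Pair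

variable {k : Type u} [Field k] {n : ℕ} {w : Fin n → ℕ} {q : Fin n → Fin n → k}

variable (w q) in
/-- The possible ratios of `x_j ^ lcmExp w j i` to `x_i ^ lcmExp w i j` on a line of a module on
which only `x_i` and `x_j` act nontrivially; the condition is the relation `∑ x_l ^ h_l = 0`. -/
def slopeSet (i j : Fin n) : Set k :=
  {ν | ν ^ edgeLength w i j * edgeParam w q i j ^ (edgeLength w i j).choose 2 = -1}

variable (q) in
include q in
lemma tendsto_add_mul_sum_weight [IsAdmissible w q] (i : Fin n) (r : ℕ) :
    Tendsto (fun s : ℕ => (r + (s * ∑ l, w l : ℕ) : ℤ)) atTop atTop := by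
  refine tendsto_atTop_mono (fun s => ?_) tendsto_natCast_atTop_atTop
  have := Nat.le_mul_of_pos_right s (IsAdmissible.sum_weight_pos q i : 0 < ∑ l, w l)
  omega

namespace GrMod

variable {M N : GrMod k (hypGrading w q)} {i j : Fin n} {a : ℤ} {x : M.carrier} {y : N.carrier}
  {r r' : ℕ} {ν ν' : k}

/-- The module `M` has active generators `x_i` and `x_j`, and their powers of degree
`lcm (w i) (w j)` have ratio `ν` on some line in degree `r + s * ∑ l, w l`, for all large `s`.
The step `∑ l, w l` is the degree of `x_l ^ h_l`, which commutes with every generator. -/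
def IsPairPoint (M : GrMod k (hypGrading w q)) (i j : Fin n) (r : ℕ) (ν : k) : Prop :=
  M.active = {i, j} ∧ ∀ᶠ s : ℕ in atTop, ∃ x ∈ M.deg (r + (s * ∑ l, w l : ℕ)),
    x ≠ 0 ∧ edgeGen w q j i • x = ν • edgeGen w q i j • x

lemma slope_ne_zero (hj : j ∈ M.active) (hx0 : x ≠ 0)
    (hx : edgeGen w q j i • x = ν • edgeGen w q i j • x) : ν ≠ 0 := by
  rintro rfl
  rw [zero_smul] at hx
  exact hx0 ((isSMulRegular_edgeGen hj i).right_eq_zero_of_smul hx)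

variable [IsAdmissible w q]

lemma edgeGen_smul_gen_pow_expo_smul (i j : Fin n) (s : ℕ)
    (hx : edgeGen w q j i • x = ν • edgeGen w q i j • x) :
    edgeGen w q j i • op (gen w q i) ^ (s * expo w i) • x =
      ν • edgeGen w q i j • op (gen w q i) ^ (s * expo w i) • x := by
  have hparam : q i j ^ (lcmExp w j i * (s * expo w i)) = 1 := by
    rw [← mul_assoc, pow_mul', IsAdmissible.param_pow_left, one_pow]
  rw [smul_smul, edgeGen, pow_mul_pow_of_mul_eq_smul (op_gen_mul_op_gen i j), hparam, one_smul,
    mul_smul, ← edgeGen, hx, smul_comm _ ν, smul_smul _ (edgeGen w q i j), edgeGen,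
    ((Commute.refl _).pow_pow _ _).eq, mul_smul]

lemma gen_pow_expo_smul_mem (hx : x ∈ M.deg a) (i : Fin n) (s : ℕ) :
    op (gen w q i) ^ (s * expo w i) • x ∈ M.deg (a + (s * ∑ l, w l : ℕ)) := by
  have hmem := gen_pow_smul_mem hx i (s * expo w i)
  rwa [mul_assoc, IsAdmissible.expo_mul_weight q i] at hmem

lemma isPairPoint_of_slope (hact : M.active = {i, j}) {s₀ : ℕ}
    (hxa : x ∈ M.deg (r + (s₀ * ∑ l, w l : ℕ))) (hx0 : x ≠ 0)
    (hx : edgeGen w q j i • x = ν • edgeGen w q i j • x) : M.IsPairPoint i j r ν := by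
  have hi : i ∈ M.active := hact ▸ Set.mem_insert i {j}
  refine ⟨hact, ?_⟩
  filter_upwards [eventually_ge_atTop s₀] with s hs
  obtain ⟨s, rfl⟩ := Nat.exists_eq_add_of_le hs
  refine ⟨op (gen w q i) ^ (s * expo w i) • x, ?_, fun h => hx0
    ((IsSMulRegular.pow _ hi).right_eq_zero_of_smul h), edgeGen_smul_gen_pow_expo_smul i j s hx⟩
  rw [add_mul, Nat.cast_add, ← add_assoc]
  exact gen_pow_expo_smul_mem hxa i s

namespace IsOneCritical

lemma smul_eq_zero_of_active_eq_pair (hM : M.IsOneCritical) (hact : M.active = {i, j})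
    (l : Fin n) (hli : l ≠ i) (hlj : l ≠ j) (m : M.carrier) : op (gen w q l) • m = 0 :=
  hM.smul_eq_zero_of_notMem_active (by rw [hact]; exact not_or.2 ⟨hli, hlj⟩) m

lemma mem_slopeSet (hM : M.IsOneCritical) (hij : i ≠ j) (hact : M.active = {i, j}) (hx0 : x ≠ 0)
    (hx : edgeGen w q j i • x = ν • edgeGen w q i j • x) : ν ∈ slopeSet w q i j := by
  have hi : i ∈ M.active := hact ▸ Set.mem_insert i {j}
  have hsum := M.sum_gen_pow_smul x
  rw [Fintype.sum_eq_add i j hij fun l hl => IsAdmissible.gen_pow_expo_smul_eq_zero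
      (hM.smul_eq_zero_of_active_eq_pair hact l hl.1 hl.2) x,
    ← IsAdmissible.lcmExp_mul_edgeLength q i j, ← IsAdmissible.lcmExp_mul_edgeLength q j i,
    edgeLength_comm j i, pow_mul, pow_mul, ← edgeGen, ← edgeGen,
    pow_smul_eq_of_smul_eq (edgeGen_mul_edgeGen i j) hx] at hsum
  nth_rw 1 [← one_smul k (edgeGen w q i j ^ edgeLength w i j • x)] at hsum
  rw [← add_smul] at hsum
  refine eq_neg_of_add_eq_zero_right ((smul_eq_zero.1 hsum).resolve_right fun h => hx0 ?_)
  exact ((isSMulRegular_edgeGen hi j).pow _).right_eq_zero_of_smul h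

lemma ker_orbit_le_of_slope_eq (hM : M.IsOneCritical) (hN : N.IsOneCritical)
    (hMact : M.active = {i, j}) (hNact : N.active = {i, j}) (hxa : x ∈ M.deg a) (hx0 : x ≠ 0)
    (hya : y ∈ N.deg a) (hx : edgeGen w q j i • x = ν • edgeGen w q i j • x)
    (hy : edgeGen w q j i • y = ν • edgeGen w q i j • y) :
    LinearMap.ker (M.orbit x) ≤ LinearMap.ker (N.orbit y) := by
  have hi : i ∈ M.active := hMact ▸ Set.mem_insert i {j}
  have hj : j ∈ M.active := hMact ▸ Set.mem_insert_of_mem i rfl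
  have hV (l : Fin n) (hli : l ≠ i) (hlj : l ≠ j) (u : M.carrier × N.carrier) :
      op (gen w q l) • u = 0 :=
    Prod.ext (hM.smul_eq_zero_of_active_eq_pair hMact l hli hlj u.1)
      (hN.smul_eq_zero_of_active_eq_pair hNact l hli hlj u.2)
  refine ker_orbit_le_of_homogeneous IsFGGrading.iSup_eq_top hxa hya fun t r hr hrx => ?_
  by_cases ht : ∀ a b, a * w i + b * w j ≠ t
  · exact congrArg Prod.snd (op_smul_eq_zero_of_forall_ne hV ht hr (x, y))
  push Not at ht
  obtain ⟨a, b, rfl⟩ := ht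
  obtain ⟨c, hc⟩ := exists_op_smul_eq_edgeMonomial_smul (v := (x, y)) hV
    (IsAdmissible.weight_pos q i) (IsAdmissible.weight_pos q j) (IsAdmissible.param_ne_zero w i j)
    (slope_ne_zero hj hx0 hx) (Prod.ext hx hy) hr
  have hcx : op r • x = c • edgeMonomial w q i j a b • x := congrArg Prod.fst hc
  have hcy : op r • y = c • edgeMonomial w q i j a b • y := congrArg Prod.snd hc
  rw [hrx, eq_comm, smul_eq_zero] at hcx
  rw [hcy, hcx.resolve_right fun h =>
    hx0 ((isSMulRegular_edgeMonomial hi hj a b).right_eq_zero_of_smul h), zero_smul]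

lemma qgrClass_eq_of_isPairPoint (hM : M.IsOneCritical) (hN : N.IsOneCritical)
    (hMν : M.IsPairPoint i j r ν) (hNν : N.IsPairPoint i j r ν) : M.qgrClass = N.qgrClass := by
  obtain ⟨s, ⟨x, hxa, hx0, hx⟩, ⟨y, hya, hy0, hy⟩⟩ := (hMν.2.and hNν.2).exists
  exact hM.qgrClass_eq_of_ker_orbit_eq hN hxa hx0 hya hy0 (le_antisymm
    (hM.ker_orbit_le_of_slope_eq hN hMν.1 hNν.1 hxa hx0 hya hx hy)
    (hN.ker_orbit_le_of_slope_eq hM hNν.1 hMν.1 hya hy0 hxa hy hx))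

lemma eventually_slope (hM : M.IsOneCritical) (hMν : M.IsPairPoint i j r ν) :
    ∀ᶠ s : ℕ in atTop, ∀ m ∈ M.deg (r + (s * ∑ l, w l : ℕ)),
      edgeGen w q j i • m = ν • edgeGen w q i j • m := by
  obtain ⟨hact, hslope⟩ := hMν
  have hj : j ∈ M.active := hact ▸ Set.mem_insert_of_mem i rfl
  obtain ⟨s₀, x, hxa, hx0, hx⟩ := hslope.exists
  obtain ⟨T, hT⟩ := eventually_atTop.1 (hM.eventually_deg_eq_orbit_map hxa hx0)
  filter_upwards [eventually_ge_atTop (s₀ + T)] with s hs m hm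
  obtain ⟨s, rfl⟩ := Nat.exists_eq_add_of_le (le_of_add_le_left hs)
  have hsT : T ≤ s * ∑ l, w l := (Nat.le_of_add_le_add_left hs).trans
    (Nat.le_mul_of_pos_right s (IsAdmissible.sum_weight_pos q i))
  rw [add_mul, Nat.cast_add, ← add_assoc, hT _ hsT] at hm
  obtain ⟨t, ht, rfl⟩ := hm
  have hexp : s * ∑ l, w l = s * expo w i * w i + 0 * w j := by
    rw [zero_mul, add_zero, mul_assoc, IsAdmissible.expo_mul_weight q i]
  obtain ⟨c, hc⟩ := exists_op_smul_eq_edgeMonomial_smul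
    (hM.smul_eq_zero_of_active_eq_pair hact) (IsAdmissible.weight_pos q i)
    (IsAdmissible.weight_pos q j) (IsAdmissible.param_ne_zero w i j)
    (slope_ne_zero hj hx0 hx) hx (hexp ▸ ht : t ∈ hypGrading w q _)
  rw [orbit_apply, hc, edgeMonomial, pow_zero, one_mul, smul_comm _ c, smul_comm _ c,
    edgeGen_smul_gen_pow_expo_smul i j s hx, smul_comm c ν]

lemma eventually_modEq (hM : M.IsOneCritical) (hMν : M.IsPairPoint i j r ν) :
    ∀ᶠ a in atTop, M.deg a ≠ ⊥ → a ≡ r [ZMOD (w i).gcd (w j)] := by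
  obtain ⟨hact, hslope⟩ := hMν
  obtain ⟨s, x, hxa, hx0, -⟩ := hslope.exists
  obtain ⟨T, hT⟩ := eventually_atTop.1 (hM.eventually_deg_eq_orbit_map hxa hx0)
  filter_upwards [eventually_ge_atTop (r + (s * ∑ l, w l : ℕ) + T : ℤ)] with a ha hne
  obtain ⟨t, rfl⟩ : ∃ t : ℕ, a = r + (s * ∑ l, w l : ℕ) + t :=
    ⟨(a - (r + (s * ∑ l, w l : ℕ))).toNat, by omega⟩
  rw [hT t (by omega), Submodule.ne_bot_iff] at hne
  obtain ⟨_, ⟨z, hz, rfl⟩, hzx⟩ := hne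
  obtain ⟨a, b, rfl⟩ : ∃ a b, a * w i + b * w j = t := by
    by_contra! ht
    exact hzx (op_smul_eq_zero_of_forall_ne (hM.smul_eq_zero_of_active_eq_pair hact) ht hz x)
  have hdvd : (w i).gcd (w j) ∣ s * ∑ l, w l + (a * w i + b * w j) :=
    (((Nat.gcd_dvd_left _ _).trans (IsAdmissible.weight_dvd q i)).mul_left s).add
      (((Nat.gcd_dvd_left _ _).mul_left a).add ((Nat.gcd_dvd_right _ _).mul_left b))
  rw [add_assoc, ← Nat.cast_add]
  exact (Int.modEq_iff_dvd.2 (by simpa using Int.natCast_dvd_natCast.2 hdvd)).symm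

lemma residue_eq_of_isPairPoint (hM : M.IsOneCritical) (hN : N.IsOneCritical)
    (hMN : M.qgrClass = N.qgrClass) (hMν : M.IsPairPoint i j r ν) (hNν : N.IsPairPoint i j r' ν')
    (hr : r < (w i).gcd (w j)) (hr' : r' < (w i).gcd (w j)) : r = r' := by
  have hMmod : ∀ᶠ a in atTop ⊓ 𝓟 {a : ℤ | ¬ a ≡ r [ZMOD (w i).gcd (w j)]},
      ∀ m ∈ M.deg a, op (1 : HypAlg w q) • m = 0 := by
    rw [eventually_inf_principal]
    filter_upwards [hM.eventually_modEq hMν] with a ha hmod m hm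
    rw [(Submodule.eq_bot_iff _).1 (not_not.1 (mt ha hmod)) m hm, smul_zero]
  have hNmod := hM.eventually_smul_eq_zero_of_qgrClass_eq hN hMN inf_le_left hMmod
  rw [eventually_inf_principal] at hNmod
  obtain ⟨s, ⟨x, hx, hx0, -⟩, hs⟩ := (hNν.2.and
    ((tendsto_add_mul_sum_weight (w := w) q i r').eventually hNmod)).exists
  have hmod : (r' + (s * ∑ l, w l : ℕ) : ℤ) ≡ r [ZMOD (w i).gcd (w j)] := by
    by_contra hmod
    exact hx0 ((one_smul _ x).symm.trans (hs hmod x hx))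
  have hdvd : (w i).gcd (w j) ∣ s * ∑ l, w l :=
    ((Nat.gcd_dvd_left _ _).trans (IsAdmissible.weight_dvd q i)).mul_left s
  have hmod' : r' + s * ∑ l, w l ≡ r [MOD (w i).gcd (w j)] :=
    Int.natCast_modEq_iff.1 (by rwa [Nat.cast_add])
  refine (Nat.ModEq.eq_of_lt_of_lt (Nat.ModEq.trans ?_ hmod') hr' hr).symm
  simpa only [add_zero] using (Nat.ModEq.refl r').add (Nat.modEq_zero_iff_dvd.2 hdvd).symm

lemma slope_eq_of_isPairPoint (hM : M.IsOneCritical) (hN : N.IsOneCritical)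
    (hMN : M.qgrClass = N.qgrClass) (hMν : M.IsPairPoint i j r ν) (hNν : N.IsPairPoint i j r ν') :
    ν = ν' := by
  have hop : op (gen w q j ^ lcmExp w j i - ν • gen w q i ^ lcmExp w i j) =
      edgeGen w q j i - ν • edgeGen w q i j := by
    rw [MulOpposite.op_sub, op_smul, op_pow, op_pow, edgeGen, edgeGen]
  have hNslope := hM.eventually_smul_eq_zero_of_qgrClass_eq hN hMN
    (tendsto_add_mul_sum_weight q i r)
    (z := gen w q j ^ lcmExp w j i - ν • gen w q i ^ lcmExp w i j)
    (eventually_map.2 ((hM.eventually_slope hMν).mono fun s hs m hm => by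
      rw [hop, sub_smul, hs m hm, smul_assoc, sub_self]))
  obtain ⟨s, ⟨x, hx, hx0, hxν⟩, hs⟩ := (hNν.2.and (eventually_map.1 hNslope)).exists
  have hX : edgeGen w q i j • x ≠ 0 := fun h => hx0
    ((isSMulRegular_edgeGen (hNν.1 ▸ Set.mem_insert i {j}) j).right_eq_zero_of_smul h)
  have hsx := hs x hx
  rw [hop, sub_smul, hxν, smul_assoc, ← sub_smul, smul_eq_zero] at hsx
  exact (sub_eq_zero.1 (hsx.resolve_right hX)).symm

end IsOneCritical

end GrMod

end Pair

lemma exists_apply_eq_smul_apply {k V W : Type*} [Field k] [IsAlgClosed k] [AddCommGroup V]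
    [Module k V] [AddCommGroup W] [Module k W] [FiniteDimensional k V] [FiniteDimensional k W]
    [Nontrivial V] (hVW : Module.finrank k V = Module.finrank k W) {X : V →ₗ[k] W}
    (hX : Function.Injective X) (Y : V →ₗ[k] W) : ∃ v ≠ 0, ∃ ν : k, Y v = ν • X v := by
  let e := LinearEquiv.ofInjectiveOfFinrankEq X hX hVW
  obtain ⟨ν, hν⟩ := Module.End.exists_eigenvalue (e.symm.toLinearMap ∘ₗ Y)
  obtain ⟨v, hv, hv0⟩ := hν.exists_hasEigenvector
  refine ⟨v, hv0, ν, ?_⟩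
  have hv := congrArg e (Module.End.mem_eigenspace_iff.1 hv)
  rwa [LinearMap.comp_apply, LinearEquiv.coe_coe, e.apply_symm_apply, map_smul] at hv

section Slope

variable {k : Type u} [Field k] {A : Type u} [Ring A] [Algebra k A] {𝒜 : ℕ → Submodule k A}
  [IsFGGrading 𝒜] {M : GrMod k 𝒜}

lemma GrMod.HasMultiplicity.eventually_hilb_add_eq {e : ℝ} (he : M.HasMultiplicity e)
    (hM : M.gkdim = 1) {D : ℕ} (hD : 0 < D) {z : A} (hz : z ∈ 𝒜 D)
    (hreg : IsSMulRegular M.carrier (op z)) : ∀ᶠ a in atTop, M.hilb (a + D) = M.hilb a := by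
  have hinc := hilb_le_add_of_isSMulRegular hz hreg
  exact eventually_atTop.2 (exists_add_eq_of_le_add_of_bounded hinc fun a =>
    Nat.cast_le.1 ((he.hilb_le hM hD hinc a).trans (Nat.le_ceil _)))

lemma GrMod.HasMultiplicity.eventually_exists_smul_eq_smul_smul [IsAlgClosed k] {e : ℝ}
    (he : M.HasMultiplicity e) (hM : M.gkdim = 1) {D : ℕ} (hD : 0 < D) {z z' : A} (hz : z ∈ 𝒜 D)
    (hreg : IsSMulRegular M.carrier (op z)) (hz' : z' ∈ 𝒜 D) :
    ∀ᶠ a in atTop, M.deg a ≠ ⊥ → ∃ x ∈ M.deg a, x ≠ 0 ∧ ∃ ν : k, op z' • x = ν • op z • x := by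
  filter_upwards [he.eventually_hilb_add_eq hM hD hz hreg] with a ha hne
  have hnontriv : Nontrivial (M.deg a) := Submodule.nontrivial_iff_ne_bot.2 hne
  let mulBy (y : A) (hy : y ∈ 𝒜 D) : M.deg a →ₗ[k] M.deg (a + D) :=
    (DistribSMul.toLinearMap k M.carrier (op y)).restrict fun x hx => M.smul_mem a D x y hx hy
  have hinj : Function.Injective (mulBy z hz) := fun x y hxy =>
    Subtype.ext (hreg (congrArg Subtype.val hxy))
  obtain ⟨x, hx0, ν, hx⟩ := exists_apply_eq_smul_apply ha.symm hinj (mulBy z' hz')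
  exact ⟨x, x.2, fun h => hx0 (Subtype.ext h), ν, congrArg Subtype.val hx⟩

end Slope

section Pair

variable {k : Type u} [Field k] {n : ℕ} {w : Fin n → ℕ} {q : Fin n → Fin n → k}
  [IsAdmissible w q] {M : GrMod k (hypGrading w q)} {i j : Fin n}

namespace GrMod

namespace IsOneCritical

lemma eventually_exists_slope [IsAlgClosed k] (hM : M.IsOneCritical) {e : ℝ}
    (he : M.HasMultiplicity e) (hi : i ∈ M.active) (j : Fin n) :
    ∀ᶠ a in atTop, M.deg a ≠ ⊥ →
      ∃ x ∈ M.deg a, x ≠ 0 ∧ ∃ ν : k, edgeGen w q j i • x = ν • edgeGen w q i j • x := by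
  have hmem (i j : Fin n) : gen w q i ^ lcmExp w i j ∈ hypGrading w q ((w i).lcm (w j)) := by
    rw [← lcmExp_mul_weight]
    exact SetLike.pow_mem_graded _ (gen_mem_hypGrading i)
  have hpos : 0 < (w i).lcm (w j) :=
    Nat.lcm_pos (IsAdmissible.weight_pos q i) (IsAdmissible.weight_pos q j)
  have hreg : IsSMulRegular M.carrier (op (gen w q i ^ lcmExp w i j)) :=
    op_pow (gen w q i) _ ▸ isSMulRegular_edgeGen hi j
  have hslope := he.eventually_exists_smul_eq_smul_smul hM.1 hpos (hmem i j) hreg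
    (Nat.lcm_comm (w i) (w j) ▸ hmem j i)
  simpa only [edgeGen, op_pow] using hslope

lemma exists_residue (hM : M.IsOneCritical) (hi : i ∈ M.active) (hj : j ∈ M.active) :
    ∃ r < (w i).gcd (w j), ∀ᶠ s : ℕ in atTop, M.deg (r + (s * ∑ l, w l : ℕ)) ≠ ⊥ := by
  obtain ⟨a, -, hne⟩ := hM.exists_deg_ne_bot 0
  obtain ⟨x, hxa, hx0⟩ := (Submodule.ne_bot_iff _).1 hne
  have hg : 0 < (w i).gcd (w j) := Nat.gcd_pos_of_pos_left _ (IsAdmissible.weight_pos q i)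
  have hmod := Int.emod_nonneg a (Int.natCast_ne_zero.2 hg.ne')
  refine ⟨(a % (w i).gcd (w j)).toNat,
    (Int.toNat_lt hmod).2 (Int.emod_lt_of_pos _ (Int.natCast_pos.2 hg)), ?_⟩
  filter_upwards [(tendsto_add_mul_sum_weight (w := w) q i _).eventually_ge_atTop
    (a + ((w i).pred * (w j).pred : ℕ))] with s hs
  rw [Int.toNat_of_nonneg hmod] at hs ⊢
  have hmodEq : a ≡ a % (w i).gcd (w j) + (s * ∑ l, w l : ℕ) [ZMOD (w i).gcd (w j)] :=
    (Int.mod_modEq a _).symm.trans (Int.modEq_iff_dvd.2 (by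
      rw [add_sub_cancel_left]
      exact Int.natCast_dvd_natCast.2
        (((Nat.gcd_dvd_left _ _).trans (IsAdmissible.weight_dvd q i)).mul_left s)))
  obtain ⟨u, v, hmem, hne⟩ := exists_edgeMonomial_smul_mem hi hj hmodEq hs hxa hx0
  exact (Submodule.ne_bot_iff _).2 ⟨_, hmem, hne⟩

theorem exists_isPairPoint [IsAlgClosed k] (hM : M.IsOneCritical) {e : ℝ}
    (he : M.HasMultiplicity e) (hij : i ≠ j) (hact : M.active = {i, j}) :
    ∃ r < (w i).gcd (w j), ∃ ν ∈ slopeSet w q i j, M.IsPairPoint i j r ν := by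
  have hi : i ∈ M.active := hact ▸ Set.mem_insert i {j}
  have hj : j ∈ M.active := hact ▸ Set.mem_insert_of_mem i rfl
  obtain ⟨r, hr, hdeg⟩ := hM.exists_residue hi hj
  obtain ⟨s₀, hne, hslope⟩ := (hdeg.and ((tendsto_add_mul_sum_weight (w := w) q i r).eventually
    (hM.eventually_exists_slope he hi j))).exists
  obtain ⟨x, hxa, hx0, ν, hx⟩ := hslope hne
  exact ⟨r, hr, ν, hM.mem_slopeSet hij hact hx0 hx, isPairPoint_of_slope hact hxa hx0 hx⟩

end IsOneCritical

end GrMod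

end Pair

/-! ### Modules presented by the action of the generators -/

section GradedRep

variable {k : Type u} [Field k] {n : ℕ} {w : Fin n → ℕ} {q : Fin n → Fin n → k}

lemma smul_mem_of_gen_smul_mem {V : Type*} [AddCommGroup V] [Module k V]
    [Module (HypAlg w q)ᵐᵒᵖ V] [IsScalarTower k (HypAlg w q)ᵐᵒᵖ V] {U : Submodule k V}
    (hU : ∀ i, ∀ v ∈ U, op (gen w q i) • v ∈ U) (r : (HypAlg w q)ᵐᵒᵖ) {v : V} (hv : v ∈ U) :
    r • v ∈ U := by
  let stabilizer : Submodule k (HypAlg w q) := U.comap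
    ((LinearMap.toSpanSingleton (HypAlg w q)ᵐᵒᵖ V v).restrictScalars k ∘ₗ
      (opLinearEquiv k : HypAlg w q ≃ₗ[k] _).toLinearMap)
  have hle : ⨆ t, hypGrading w q t ≤ stabilizer := iSup_le <| hypGrading_le
    (U := fun _ => stabilizer) (by simpa [stabilizer] using hv) fun _ i r hr => by
      change op (r * gen w q i) • v ∈ U
      rw [op_mul, mul_smul]
      exact hU i _ hr
  exact hle (iSup_hypGrading (w := w) (q := q) ▸ Submodule.mem_top : r.unop ∈ _)

variable (w q) in
/-- A finitely generated graded right module over `C/(f)`, given by the operators through which the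
generators act. -/
structure GradedRep where
  carrier : Type u
  [addCommGroup : AddCommGroup carrier]
  [module : Module k carrier]
  deg : ℤ → Submodule k carrier
  isInternal : DirectSum.IsInternal deg
  act : Fin n → Module.End k carrier
  act_mem : ∀ i a, ∀ v ∈ deg a, act i v ∈ deg (a + w i)
  comm : ∀ i j, act i * act j = q j i • (act j * act i)
  hyp : ∑ i, act i ^ expo w i = 0
  exists_generators : ∃ S : Finset carrier, ∀ U : Submodule k carrier, (S : Set carrier) ⊆ U →
    (∀ i, ∀ v ∈ U, act i v ∈ U) → U = ⊤

attribute [instance] GradedRep.addCommGroup GradedRep.module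

namespace GradedRep

variable (R : GradedRep w q)

/-- The algebra map through which `C/(f)` acts on the right. -/
def toEnd : (HypAlg w q)ᵐᵒᵖ →ₐ[k] Module.End k R.carrier :=
  AlgHom.opComm <| RingQuot.liftAlgHom k ⟨FreeAlgebra.lift k fun i => op (R.act i), by
    rintro _ _ (⟨i, j⟩ | _)
    · simp only [map_mul, FreeAlgebra.lift_ι_apply, map_smul, ← op_mul, ← op_smul, R.comm i j]
    · simp only [map_sum, map_pow, FreeAlgebra.lift_ι_apply, map_zero, ← op_pow]
      rw [← Finset.op_sum, R.hyp, op_zero]⟩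

lemma toEnd_gen (i : Fin n) : R.toEnd (op (gen w q i)) = R.act i := by
  simp [toEnd, gen]

/-- The object of `gr(C/(f))` given by a family of operators. -/
def toGrMod : GrMod k (hypGrading w q) :=
  letI : Module (HypAlg w q)ᵐᵒᵖ R.carrier := Module.compHom _ R.toEnd.toRingHom
  have hgen (i : Fin n) (v : R.carrier) : op (gen w q i) • v = R.act i v :=
    congrArg (fun φ : Module.End k R.carrier => φ v) (R.toEnd_gen i)
  have : IsScalarTower k (HypAlg w q)ᵐᵒᵖ R.carrier :=
    ⟨fun c r v => congrArg (fun φ : Module.End k R.carrier => φ v) (map_smul R.toEnd c r)⟩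
  { carrier := R.carrier
    deg := R.deg
    isInternal := R.isInternal
    smul_mem := fun a t v r hv hr => hypGrading_le
      (U := fun t => (R.deg (a + t)).comap (R.toEnd.toLinearMap.flip v ∘ₗ
        (opLinearEquiv k : HypAlg w q ≃ₗ[k] _).toLinearMap))
      (by simpa using hv)
      (fun t i r hr => by
        change R.toEnd (op (r * gen w q i)) v ∈ R.deg (a + (t + w i : ℕ))
        rw [op_mul, map_mul, toEnd_gen, Nat.cast_add, ← add_assoc]
        exact R.act_mem i _ _ hr) t hr
    finite := by
      obtain ⟨S, hS⟩ := R.exists_generators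
      refine ⟨⟨S, ?_⟩⟩
      have htop := hS ((Submodule.span (HypAlg w q)ᵐᵒᵖ (S : Set R.carrier)).restrictScalars k)
        Submodule.subset_span fun i v hv => by
          rw [← hgen]
          exact Submodule.smul_mem (Submodule.span (HypAlg w q)ᵐᵒᵖ (S : Set R.carrier)) _ hv
      exact (Submodule.restrictScalars_eq_top_iff k _ _).1 htop }

lemma gen_smul (i : Fin n) (v : R.toGrMod.carrier) : op (gen w q i) • v = R.act i v :=
  congrArg (fun φ : Module.End k R.carrier => φ v) (R.toEnd_gen i)

lemma gen_pow_smul (i : Fin n) (t : ℕ) (v : R.toGrMod.carrier) :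
    op (gen w q i) ^ t • v = (R.act i ^ t) v :=
  congrArg (fun φ : Module.End k R.carrier => φ v)
    ((map_pow R.toEnd _ t).trans (congrArg (· ^ t) (R.toEnd_gen i)))

lemma mem_active_iff {i : Fin n} : i ∈ R.toGrMod.active ↔ Function.Injective (R.act i) :=
  iff_of_eq (congrArg Function.Injective (funext (R.gen_smul i)))

end GradedRep

end GradedRep

/-! ### Three active generators give infinitely many points -/

section Triple

variable {k : Type u} [Field k] {n : ℕ} {w : Fin n → ℕ} {q : Fin n → Fin n → k}

lemma commute_gen_pow_expo [IsAdmissible w q] (i : Fin n) (r : HypAlg w q) :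
    Commute (gen w q i ^ expo w i) r := by
  have hle : ⨆ t, hypGrading w q t ≤ (LinearMap.mulLeft k (gen w q i ^ expo w i)).eqLocus
      (LinearMap.mulRight k (gen w q i ^ expo w i)) := iSup_le <| hypGrading_le
    (Commute.one_right _) fun _ j _ hr => by
      refine Commute.mul_right hr ?_
      rw [Commute, SemiconjBy, pow_mul_of_mul_eq_smul (gen_mul_gen j i),
        IsAdmissible.param_pow_left, one_smul]
  exact hle (iSup_hypGrading (w := w) (q := q) ▸ Submodule.mem_top)

lemma gen_pow_expo_mem [IsAdmissible w q] (i : Fin n) :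
    gen w q i ^ expo w i ∈ hypGrading w q (∑ l, w l) := by
  rw [← IsAdmissible.expo_mul_weight q i]
  exact SetLike.pow_mem_graded _ (gen_mem_hypGrading i)

namespace GrMod

section Rescale

variable (M : GrMod k (hypGrading w q)) (c : Fin n → k) (hc0 : ∀ i, c i ≠ 0)
  (hc : ∀ m : M.carrier, ∑ i, c i ^ expo w i • op (gen w q i) ^ expo w i • m = 0)

/-- The twist of `M` in which `x_i` acts as `c i • x_i`. -/
def rescale : GrMod k (hypGrading w q) :=
  GradedRep.toGrMod
  { carrier := M.carrier
    deg := M.deg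
    isInternal := M.isInternal
    act := fun i => c i • Algebra.lsmul k k M.carrier (op (gen w q i))
    act_mem := fun i a v hv =>
      Submodule.smul_mem _ _ (M.smul_mem a (w i) v _ hv (gen_mem_hypGrading i))
    comm := fun i j => LinearMap.ext fun v => by
      simp only [Module.End.mul_apply, LinearMap.smul_apply, Algebra.lsmul_coe,
        smul_comm (op _) (c _), gen_smul_comm i j v, smul_comm _ (q j i), smul_comm (c i) (c j)]
    hyp := LinearMap.ext fun v => by
      simpa only [LinearMap.sum_apply, smul_pow, ← map_pow, LinearMap.smul_apply,
        LinearMap.zero_apply, Algebra.lsmul_coe] using hc v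
    exists_generators := by
      obtain ⟨S, hS⟩ := M.finite
      refine ⟨S, fun U hSU hU => U.eq_top_iff'.2 fun v => ?_⟩
      have hstable (i : Fin n) (v : M.carrier) (hv : v ∈ U) : op (gen w q i) • v ∈ U :=
        (U.smul_mem_iff (hc0 i)).1 (hU i v hv)
      have hv : v ∈ Submodule.span (HypAlg w q)ᵐᵒᵖ (S : Set M.carrier) := hS ▸ Submodule.mem_top
      induction hv using Submodule.span_induction with
      | mem v hv => exact hSU hv
      | zero => exact U.zero_mem
      | add v v' _ _ hv hv' => exact U.add_mem hv hv'
      | smul r v _ hv => exact smul_mem_of_gen_smul_mem hstable r hv }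

/-- The identity of the underlying graded vector space. -/
def toRescale : M.carrier ≃ₗ[k] (M.rescale c hc0 hc).carrier := LinearEquiv.refl k _

variable {M c}

lemma gen_smul_toRescale (i : Fin n) (m : M.carrier) :
    op (gen w q i) • M.toRescale c hc0 hc m = c i • M.toRescale c hc0 hc (op (gen w q i) • m) :=
  GradedRep.gen_smul _ i (M.toRescale c hc0 hc m)

lemma gen_pow_smul_toRescale (i : Fin n) (e : ℕ) (m : M.carrier) :
    op (gen w q i) ^ e • M.toRescale c hc0 hc m =
      c i ^ e • M.toRescale c hc0 hc (op (gen w q i) ^ e • m) := by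
  induction e with
  | zero => simp only [pow_zero, one_smul]
  | succ e ih => rw [pow_succ', mul_smul, ih, smul_comm, gen_smul_toRescale, smul_smul, ← pow_succ,
      mul_smul]

lemma mem_active_rescale {i : Fin n} (hi : i ∈ M.active) : i ∈ (M.rescale c hc0 hc).active := by
  refine (M.toRescale c hc0 hc).surjective.forall₂.2 fun v v' hv => congrArg _ (hi ?_)
  simp only [gen_smul_toRescale] at hv
  exact (M.toRescale c hc0 hc).injective (smul_right_injective _ (hc0 i) hv)

lemma HasMultiplicity.rescale {e : ℝ} (he : M.HasMultiplicity e) :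
    (M.rescale c hc0 hc).HasMultiplicity e :=
  he

lemma toRescale_mem_span {m v : M.carrier} (hv : v ∈ Submodule.span (HypAlg w q)ᵐᵒᵖ {m}) :
    M.toRescale c hc0 hc v ∈ Submodule.span (HypAlg w q)ᵐᵒᵖ {M.toRescale c hc0 hc m} := by
  let U : Submodule k M.carrier := ((Submodule.span (HypAlg w q)ᵐᵒᵖ
    {M.toRescale c hc0 hc m}).restrictScalars k).comap (M.toRescale c hc0 hc).toLinearMap
  have hU (i : Fin n) (v : M.carrier) (hv : v ∈ U) : op (gen w q i) • v ∈ U := by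
    refine (U.smul_mem_iff (hc0 i)).1 ?_
    change M.toRescale c hc0 hc (c i • op (gen w q i) • v) ∈ Submodule.span (HypAlg w q)ᵐᵒᵖ _
    rw [map_smul, ← gen_smul_toRescale]
    exact Submodule.smul_mem _ _ hv
  obtain ⟨r, rfl⟩ := Submodule.mem_span_singleton.1 hv
  exact smul_mem_of_gen_smul_mem hU r
    (Submodule.mem_span_singleton_self (M.toRescale c hc0 hc m))

lemma IsOneCritical.rescale [IsAdmissible w q] (hM : M.IsOneCritical) :
    (M.rescale c hc0 hc).IsOneCritical := by
  refine isOneCritical_of_deg_le_span hM.1 fun i x hx hx0 => ?_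
  obtain ⟨L, hL⟩ := hM.exists_deg_le_span (M := M) hx hx0
  exact ⟨L, fun j hj v hv => toRescale_mem_span hc0 hc (hL j hj hv)⟩

end Rescale

variable {M N : GrMod k (hypGrading w q)} {x y z : Fin n} {σ σ' ρ τ : k} {e : ℝ}

/-- The ratio of the central elements `x_x ^ h_x` and `x_y ^ h_y` acting on `M` is `σ`. -/
def HasRatio (M : GrMod k (hypGrading w q)) (x y : Fin n) (σ : k) : Prop :=
  y ∈ M.active ∧
    ∀ m : M.carrier, op (gen w q x) ^ expo w x • m = σ • op (gen w q y) ^ expo w y • m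

lemma HasRatio.ne_zero [Nontrivial M.carrier] (hσ : M.HasRatio x y σ) (hx : x ∈ M.active) :
    σ ≠ 0 := by
  rintro rfl
  obtain ⟨m, hm⟩ := exists_ne (0 : M.carrier)
  have hxm := hσ.2 m
  rw [zero_smul] at hxm
  exact hm ((IsSMulRegular.pow _ hx).right_eq_zero_of_smul hxm)

namespace IsOneCritical

variable [IsAdmissible w q]

lemma nontrivial (hM : M.IsOneCritical) : Nontrivial M.carrier := by
  obtain ⟨a, -, ha⟩ := hM.exists_deg_ne_bot 0
  obtain ⟨m, -, hm⟩ := (Submodule.ne_bot_iff _).1 ha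
  exact ⟨m, 0, hm⟩

lemma exists_hasRatio [IsAlgClosed k] (hM : M.IsOneCritical) (he : M.HasMultiplicity e)
    (x : Fin n) (hy : y ∈ M.active) : ∃ σ, M.HasRatio x y σ := by
  have hreg : IsSMulRegular M.carrier (op (gen w q y ^ expo w y)) :=
    op_pow (gen w q y) _ ▸ IsSMulRegular.pow _ hy
  obtain ⟨L, hL⟩ := eventually_atTop.1 (he.eventually_exists_smul_eq_smul_smul hM.1
    (IsAdmissible.sum_weight_pos q x) (gen_pow_expo_mem y) hreg (gen_pow_expo_mem x))
  obtain ⟨a, ha, hne⟩ := hM.exists_deg_ne_bot L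
  obtain ⟨v, -, hv0, σ, hv⟩ := hL a ha hne
  have hsmul (m : M.carrier) : op (gen w q x ^ expo w x - σ • gen w q y ^ expo w y) • m =
      op (gen w q x) ^ expo w x • m - σ • op (gen w q y) ^ expo w y • m := by
    rw [MulOpposite.op_sub, op_smul, op_pow, op_pow, sub_smul, smul_assoc]
  have hnormal := IsGradedNormal.of_commute
    (Submodule.sub_mem _ (gen_pow_expo_mem x) (Submodule.smul_mem _ σ (gen_pow_expo_mem y)))
    fun r => ((commute_gen_pow_expo (w := w) (q := q) x r).sub_left
      ((commute_gen_pow_expo y r).smul_left σ))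
  refine ⟨σ, hy, fun m => sub_eq_zero.1 (hsmul m ▸ ?_)⟩
  refine (hM.smul_eq_zero_or_isSMulRegular hnormal).resolve_right (fun hreg => hv0 ?_) m
  exact hreg.right_eq_zero_of_smul (by rw [hsmul, sub_eq_zero, ← op_pow, ← op_pow, hv])

lemma ratio_eq_of_qgrClass_eq (hM : M.IsOneCritical) (hN : N.IsOneCritical)
    (hMN : M.qgrClass = N.qgrClass) (hσ : M.HasRatio x y σ) (hσ' : N.HasRatio x y σ') :
    σ = σ' := by
  have hop : op (gen w q x ^ expo w x - σ • gen w q y ^ expo w y) =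
      op (gen w q x) ^ expo w x - σ • op (gen w q y) ^ expo w y := by
    rw [MulOpposite.op_sub, op_smul, op_pow, op_pow]
  obtain ⟨L, hL⟩ := eventually_atTop.1 (hM.eventually_smul_eq_zero_of_qgrClass_eq hN hMN le_rfl
    (z := gen w q x ^ expo w x - σ • gen w q y ^ expo w y)
    (.of_forall fun a m _ => by rw [hop, sub_smul, smul_assoc, hσ.2, sub_self]))
  obtain ⟨a, ha, hne⟩ := hN.exists_deg_ne_bot L
  obtain ⟨m, hm, hm0⟩ := (Submodule.ne_bot_iff _).1 hne
  have hzero := hL a ha m hm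
  rw [hop, sub_smul, smul_assoc, hσ'.2, ← sub_smul, smul_eq_zero] at hzero
  exact (sub_eq_zero.1 (hzero.resolve_right fun h =>
    hm0 ((IsSMulRegular.pow _ hσ'.1).right_eq_zero_of_smul h))).symm

/-- Scaling `x_x ^ h_x` by `τ` can be compensated in the relation `∑ x_l ^ h_l = 0` by scaling
`x_z ^ h_z`. -/
lemma exists_hasRatio_mul [IsAlgClosed k] (hM : M.IsOneCritical) (he : M.HasMultiplicity e)
    (hxy : x ≠ y) (hxz : x ≠ z) (hyz : y ≠ z) (hσ : M.HasRatio x y σ) (hρ : M.HasRatio x z ρ)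
    (hτ : τ ≠ 0) (hτρ : 1 - (τ - 1) * ρ ≠ 0) :
    ∃ N : GrMod k (hypGrading w q), N.IsOneCritical ∧ N.HasMultiplicity e ∧
      N.HasRatio x y (τ * σ) := by
  obtain ⟨α, hα⟩ := IsAlgClosed.exists_pow_nat_eq τ (IsAdmissible.expo_pos q x : 0 < expo w x)
  obtain ⟨β, hβ⟩ := IsAlgClosed.exists_pow_nat_eq (1 - (τ - 1) * ρ)
    (IsAdmissible.expo_pos q z : 0 < expo w z)
  let c : Fin n → k := Function.update (Function.update 1 x α) z β
  have hcx : c x = α := by simp [c, hxz]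
  have hcz : c z = β := by simp [c]
  have hc1 (l : Fin n) (hlx : l ≠ x) (hlz : l ≠ z) : c l = 1 := by simp [c, hlx, hlz]
  have hc0 (l : Fin n) : c l ≠ 0 := by
    rcases eq_or_ne l x with rfl | hlx
    · exact hcx ▸ ne_zero_pow (IsAdmissible.expo_pos (w := w) q l).ne' (hα ▸ hτ)
    rcases eq_or_ne l z with rfl | hlz
    · exact hcz ▸ ne_zero_pow (IsAdmissible.expo_pos (w := w) q l).ne' (hβ ▸ hτρ)
    exact hc1 l hlx hlz ▸ one_ne_zero
  have hc (m : M.carrier) : ∑ l, c l ^ expo w l • op (gen w q l) ^ expo w l • m = 0 := by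
    refine Eq.trans ?_ (M.sum_gen_pow_smul m)
    rw [← sub_eq_zero, ← Finset.sum_sub_distrib,
      Fintype.sum_eq_add x z hxz fun l hl => by rw [hc1 l hl.1 hl.2, one_pow, one_smul, sub_self],
      hcx, hcz, hα, hβ, hρ.2]
    generalize op (gen w q z) ^ expo w z • m = v
    module
  refine ⟨M.rescale c hc0 hc, hM.rescale hc0 hc, he.rescale hc0 hc, mem_active_rescale hc0 hc hσ.1,
    (M.toRescale c hc0 hc).surjective.forall.2 fun m => ?_⟩
  rw [gen_pow_smul_toRescale, gen_pow_smul_toRescale, hσ.2, hcx, hα, hc1 y hxy.symm hyz, one_pow,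
    one_smul, map_smul, smul_smul]

theorem infinite_ordinaryThinPoints [IsAlgClosed k] (hM : M.IsOneCritical)
    (he : M.HasMultiplicity e) (he1 : e ≤ 1) (hx : x ∈ M.active) (hy : y ∈ M.active)
    (hz : z ∈ M.active) (hxy : x ≠ y) (hxz : x ≠ z) (hyz : y ≠ z) :
    (ordinaryThinPoints k (hypGrading w q)).Infinite := by
  have := hM.nontrivial
  obtain ⟨σ, hσ⟩ := hM.exists_hasRatio he x hy
  obtain ⟨ρ, hρ⟩ := hM.exists_hasRatio he x hz
  have hex (τ : k) (hτ : τ ∈ ({0, 1 + ρ⁻¹} : Set k)ᶜ) :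
      ∃ N : GrMod k (hypGrading w q), N.IsOneCritical ∧ N.HasMultiplicity e ∧
        N.HasRatio x y (τ * σ) := by
    obtain ⟨hτ0, hτρ⟩ := not_or.1 hτ
    refine hM.exists_hasRatio_mul he hxy hxz hyz hσ hρ hτ0 fun h => hτρ ?_
    rw [Set.mem_singleton_iff, ← sub_eq_iff_eq_add']
    exact eq_inv_of_mul_eq_one_left (sub_eq_zero.1 h).symm
  have : Nonempty (GrMod k (hypGrading w q)) := ⟨M⟩
  choose! N hN he hratio using hex
  refine Set.infinite_of_injOn_mapsTo (f := fun τ => (N τ).qgrClass) (fun τ hτ τ' hτ' h => ?_)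
    (fun τ hτ => ⟨N τ, hN τ hτ, ⟨e, he τ hτ, he1⟩, rfl⟩) (Set.toFinite {0, 1 + ρ⁻¹}).infinite_compl
  exact mul_right_cancel₀ (hσ.ne_zero hx)
    ((hN τ hτ).ratio_eq_of_qgrClass_eq (hN τ' hτ') h (hratio τ hτ) (hratio τ' hτ'))

end IsOneCritical

end GrMod

end Triple

/-! ### Realization of the slopes -/

section Progression

namespace GrMod

section

variable {k : Type u} [Field k] {A : Type u} [Ring A] [Algebra k A] {𝒜 : ℕ → Submodule k A}
  {M : GrMod k 𝒜} {r g : ℕ}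

lemma hasMultiplicity_of_hilb_eq_indicator (hg : 0 < g)
    (hM : M.hilb = (Set.range fun s : ℕ => (r + g * s : ℤ)).indicator 1) :
    M.HasMultiplicity (g : ℝ)⁻¹ := by
  have hlim := ((continuous_pow r).tendsto (1 : ℝ)).mono_left
    (nhdsWithin_le_nhds (s := Set.Iio 1)) |>.mul (tendsto_one_sub_div_one_sub_pow hg)
  rw [one_pow, one_mul] at hlim
  refine hlim.congr' ?_
  filter_upwards [self_mem_nhdsWithin, nhdsWithin_le_nhds (lt_mem_nhds zero_lt_one)]
    with t (ht1 : t < 1) ht0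
  have hinj : Function.Injective fun s : ℕ => (r + g * s : ℤ) := fun s s' h =>
    Nat.eq_of_mul_eq_mul_left hg (by exact_mod_cast add_left_cancel h)
  have hsum : ∑' a : ℤ, (M.hilb a : ℝ) * t ^ a = t ^ r * (1 - t ^ g)⁻¹ := by
    rw [← tsum_geometric_of_lt_one (by positivity) (pow_lt_one₀ ht0.le ht1 hg.ne'),
      ← tsum_mul_left, ← hinj.tsum_eq fun a ha => ?_]
    · refine tsum_congr fun s => ?_
      rw [hM, Set.indicator_of_mem (Set.mem_range_self s), Pi.one_apply, Nat.cast_one, one_mul,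
        zpow_add₀ ht0.ne', zpow_mul, zpow_natCast, zpow_natCast, zpow_natCast]
    · by_contra hmem
      exact ha (by simp only [hM, Set.indicator_of_notMem hmem, Nat.cast_zero, zero_mul])
  rw [hsum]
  ring

lemma gkdim_eq_one_of_hilb_eq_indicator (hg : 0 < g)
    (hM : M.hilb = (Set.range fun s : ℕ => (r + g * s : ℤ)).indicator 1) : M.gkdim = 1 := by
  refine le_antisymm (gkdim_le_one fun a => ?_) (one_le_gkdim (B := g + 1) (N := r) fun a ha => ?_)
  · exact hM ▸ Set.indicator_apply_le' (fun _ => le_rfl) fun _ => zero_le_one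
  obtain ⟨t, rfl⟩ := Int.le.dest ha
  have hmem : (r + t + (g - t % g : ℕ) : ℤ) ∈ Set.range fun s : ℕ => (r + g * s : ℤ) := by
    refine ⟨t / g + 1, ?_⟩
    have hdiv := Nat.div_add_mod t g
    have hlt := Nat.mod_lt t hg
    zify [hlt.le] at hdiv ⊢
    linear_combination hdiv
  refine ⟨g - t % g, by omega, ?_⟩
  rw [hM, Set.indicator_of_mem hmem]
  exact one_ne_zero

end

variable {k : Type u} [Field k] {n : ℕ} {w : Fin n → ℕ} {q : Fin n → Fin n → k}
  [IsAdmissible w q] {M : GrMod k (hypGrading w q)} {i j : Fin n}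

lemma isOneCritical_of_hilb_eq_indicator {r : ℕ} (hi : i ∈ M.active) (hj : j ∈ M.active)
    (hM : M.hilb = (Set.range fun s : ℕ => (r + (w i).gcd (w j) * s : ℤ)).indicator 1) :
    M.IsOneCritical := by
  have hg : 0 < (w i).gcd (w j) := Nat.gcd_pos_of_pos_left _ (IsAdmissible.weight_pos q i)
  refine isOneCritical_of_deg_le_span (gkdim_eq_one_of_hilb_eq_indicator hg hM)
    fun a x hx hx0 => ⟨a + ((w i).pred * (w j).pred : ℕ), fun b hb y hy => ?_⟩
  rcases eq_or_ne y 0 with rfl | hy0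
  · exact zero_mem _
  have hrange {a : ℤ} {x : M.carrier} (hx : x ∈ M.deg a) (hx0 : x ≠ 0) :
      M.hilb a = 1 ∧ a ≡ r [ZMOD (w i).gcd (w j)] := by
    have hpos := hilb_pos_iff.2 ((Submodule.ne_bot_iff _).2 ⟨x, hx, hx0⟩)
    obtain ⟨s, rfl⟩ := Set.mem_of_indicator_ne_zero (hM ▸ hpos.ne')
    refine ⟨by rw [hM, Set.indicator_of_mem (Set.mem_range_self s), Pi.one_apply], ?_⟩
    exact (Int.modEq_iff_dvd.2 (by simp)).symm
  obtain ⟨u, v, hmem, hne⟩ := exists_edgeMonomial_smul_mem hi hj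
    ((hrange hx hx0).2.trans (hrange hy hy0).2.symm) hb hx hx0
  obtain ⟨c, hc⟩ := (finrank_eq_one_iff_of_nonzero' (⟨_, hmem⟩ : M.deg b)
    fun h => hne (congrArg Subtype.val h)).1 (hrange hy hy0).1 ⟨y, hy⟩
  have hyc : y = c • edgeMonomial w q i j u v • x := (congrArg Subtype.val hc).symm
  rw [hyc, ← smul_assoc]
  exact Submodule.smul_mem _ _ (Submodule.mem_span_singleton_self x)

end GrMod

end Progression

section GeomShift

variable {k : Type u} [Field k] {a b : ℕ} {x y μ p : k}

/-- The operator `e_s ↦ μ * x ^ s • e_(s + b)` on the space with basis `e_0, e_1, …`. Operators of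
this kind `q`-commute with each other and will be the actions of two active generators. -/
def geomShift (b : ℕ) (μ x : k) : Module.End k (ℕ →₀ k) :=
  Finsupp.linearCombination k fun s => Finsupp.single (s + b) (μ * x ^ s)

lemma geomShift_single (b : ℕ) (μ x : k) (s : ℕ) (c : k) :
    geomShift b μ x (Finsupp.single s c) = Finsupp.single (s + b) (c * (μ * x ^ s)) := by
  rw [geomShift, Finsupp.linearCombination_single, Finsupp.smul_single, smul_eq_mul]

lemma geomShift_pow_single (b : ℕ) (μ x : k) (t s : ℕ) (c : k) :
    (geomShift b μ x ^ t) (Finsupp.single s c) =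
      Finsupp.single (s + t * b) (c * (μ ^ t * x ^ (t * s + b * t.choose 2))) := by
  induction t with
  | zero => simp
  | succ t ih =>
    rw [pow_succ', Module.End.mul_apply, ih, geomShift_single, Nat.choose_succ_succ' t 1,
      Nat.choose_one_right]
    congr 1 <;> ring

lemma geomShift_mul_geomShift (μ μ' : k) (h : y ^ a = p * x ^ b) :
    geomShift b μ y * geomShift a μ' x = p • (geomShift a μ' x * geomShift b μ y) := by
  refine Finsupp.lhom_ext fun s c => ?_
  rw [LinearMap.smul_apply, Module.End.mul_apply, Module.End.mul_apply, geomShift_single,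
    geomShift_single, geomShift_single, geomShift_single, Finsupp.smul_single, smul_eq_mul,
    add_right_comm, pow_add, pow_add, h]
  congr 1
  ring

lemma geomShift_apply_add (b : ℕ) (μ x : k) (v : ℕ →₀ k) (s : ℕ) :
    geomShift b μ x v (s + b) = v s * (μ * x ^ s) := by
  induction v using Finsupp.induction_linear with
  | zero => simp
  | add u v hu hv =>
    rw [map_add (geomShift b μ x), Finsupp.add_apply, hu, hv, Finsupp.add_apply, add_mul]
  | single t c =>
    rw [geomShift_single]
    rcases eq_or_ne t s with rfl | hts
    · rw [Finsupp.single_eq_same, Finsupp.single_eq_same]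
    · rw [Finsupp.single_eq_of_ne' hts, Finsupp.single_eq_of_ne' (by omega), zero_mul]

lemma geomShift_injective (b : ℕ) (hμ : μ ≠ 0) (hx : x ≠ 0) :
    Function.Injective (geomShift b μ x) := by
  refine (injective_iff_map_eq_zero _).2 fun v hv => Finsupp.ext fun s => ?_
  have happly := geomShift_apply_add b μ x v s
  rw [hv, Finsupp.zero_apply, eq_comm] at happly
  exact (mul_eq_zero.1 happly).resolve_right (mul_ne_zero hμ (pow_ne_zero _ hx))

lemma eq_top_of_geomShift_mem (hb : 0 < b) (hμ : μ ≠ 0) (hx : x ≠ 0) {U : Submodule k (ℕ →₀ k)}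
    (hsingle : ∀ s < b, Finsupp.single s 1 ∈ U) (hU : ∀ v ∈ U, geomShift b μ x v ∈ U) : U = ⊤ := by
  have hmem (s : ℕ) : Finsupp.single s (1 : k) ∈ U := by
    induction s using Nat.strong_induction_on with
    | _ s ih =>
      rcases lt_or_ge s b with hs | hs
      · exact hsingle s hs
      have hshift := hU _ (ih (s - b) (by omega))
      rw [geomShift_single, Nat.sub_add_cancel hs, one_mul] at hshift
      have hscale := U.smul_mem (μ * x ^ (s - b))⁻¹ hshift
      rwa [Finsupp.smul_single, smul_eq_mul,
        inv_mul_cancel₀ (mul_ne_zero hμ (pow_ne_zero _ hx))] at hscale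
  rw [eq_top_iff, ← Finsupp.basisSingleOne.span_eq, Submodule.span_le]
  rintro _ ⟨s, rfl⟩
  exact hmem s

lemma geomShift_pow_smul_single_zero {ν : k}
    (hμ : μ ^ a * y ^ (b * a.choose 2) = ν * x ^ (a * b.choose 2)) :
    geomShift b μ y ^ a • Finsupp.single 0 1 =
      ν • geomShift a 1 x ^ b • (Finsupp.single 0 1 : ℕ →₀ k) := by
  rw [Module.End.smul_def, Module.End.smul_def, geomShift_pow_single, geomShift_pow_single,
    Finsupp.smul_single, smul_eq_mul]
  simp only [mul_zero, zero_add, one_mul, one_pow, hμ, mul_comm a b]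

/-- The two monomials are proportional on the first basis vector by the choice of the slope `ν`,
and on the other ones because their ratio there differs by a power of `p ^ m = 1`. -/
lemma geomShift_pow_add_geomShift_pow_eq_zero {ν : k} {m : ℕ} (h : y ^ a = p * x ^ b)
    (hp : p ^ m = 1) (hμ : μ ^ a * y ^ (b * a.choose 2) = ν * x ^ (a * b.choose 2))
    (hν : ν ^ m * (p ^ (a * b)) ^ m.choose 2 = -1) :
    geomShift a 1 x ^ (b * m) + geomShift b μ y ^ (a * m) = 0 := by
  have hpow := pow_smul_eq_of_smul_eq (R := Module.End k (ℕ →₀ k))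
    (pow_mul_pow_of_mul_eq_smul (geomShift_mul_geomShift μ 1 h) a b)
    (geomShift_pow_smul_single_zero hμ) m
  rw [hν, ← pow_mul, ← pow_mul, Module.End.smul_def, Module.End.smul_def, geomShift_pow_single,
    geomShift_pow_single, Finsupp.smul_single, mul_right_comm b, mul_right_comm a,
    mul_comm b a, (Finsupp.single_injective _).eq_iff] at hpow
  simp only [mul_zero, zero_add, one_mul, one_pow, neg_smul, one_smul] at hpow
  have hpowm : y ^ (a * m) = x ^ (b * m) := by
    rw [pow_mul, pow_mul, h, mul_pow, hp, one_mul]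
  refine Finsupp.lhom_ext fun s c => ?_
  rw [LinearMap.add_apply, geomShift_pow_single, geomShift_pow_single, LinearMap.zero_apply,
    mul_right_comm b, mul_right_comm a, mul_comm b a, ← Finsupp.single_add, Finsupp.single_eq_zero,
    pow_add, pow_add, pow_mul y (a * m), hpowm, ← pow_mul, one_pow]
  linear_combination c * x ^ (b * m * s) * hpow

lemma exists_pow_eq_mul_pow (hab : a.Coprime b) (hp : p ≠ 0) :
    ∃ x ≠ 0, ∃ y ≠ 0, y ^ a = p * x ^ b := by
  refine ⟨p ^ (- a.gcdB b), zpow_ne_zero _ hp, p ^ a.gcdA b, zpow_ne_zero _ hp, ?_⟩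
  have hbezout := Nat.gcd_eq_gcd_ab a b
  rw [hab.gcd_eq_one, Nat.cast_one] at hbezout
  rw [← zpow_natCast, ← zpow_mul, ← zpow_natCast, ← zpow_mul, ← zpow_one_add₀ hp]
  congr 1
  linarith

end GeomShift

section ProgressionGrading

variable (k : Type u) [Field k] (r g : ℕ)

/-- The grading of the space with basis `e_0, e_1, …` in which `e_s` has degree `r + g * s`. -/
def progressionGrading (a : ℤ) : Submodule k (ℕ →₀ k) :=
  Finsupp.supported k k {s | (r + g * s : ℤ) = a}

lemma isInternal_progressionGrading : DirectSum.IsInternal (progressionGrading k r g) := by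
  refine DirectSum.isInternal_submodule_of_iSupIndep_of_iSup_eq_top (fun a => ?_) ?_
  · have hle : ⨆ b, ⨆ _ : b ≠ a, progressionGrading k r g b ≤
        Finsupp.supported k k {s : ℕ | (r + g * s : ℤ) = a}ᶜ :=
      iSup₂_le fun b hb => Finsupp.supported_mono fun s hs hs' => hb (Eq.trans (Eq.symm hs) hs')
    exact (Finsupp.disjoint_supported_supported disjoint_compl_right).mono_right hle
  · have hunion : ⋃ a : ℤ, {s : ℕ | (r + g * s : ℤ) = a} = Set.univ :=
      Set.iUnion_eq_univ_iff.2 fun s => ⟨r + g * s, rfl⟩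
    exact (Finsupp.supported_iUnion _).symm.trans (hunion ▸ Finsupp.supported_univ)

variable {k r g}

lemma geomShift_mem_progressionGrading {a : ℤ} {v : ℕ →₀ k} (hv : v ∈ progressionGrading k r g a)
    (b : ℕ) (μ x : k) : geomShift b μ x v ∈ progressionGrading k r g (a + (g * b : ℕ)) := by
  rw [progressionGrading, Finsupp.supported_eq_span_single] at hv
  refine (Submodule.span_le (p := (progressionGrading k r g (a + (g * b : ℕ))).comap
    (geomShift b μ x))).2 ?_ hv
  rintro _ ⟨s, rfl, rfl⟩
  rw [SetLike.mem_coe, Submodule.mem_comap, geomShift_single]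
  refine Finsupp.single_mem_supported k _ ?_
  change (r + g * (s + b : ℕ) : ℤ) = r + g * s + (g * b : ℕ)
  push_cast
  ring

lemma finrank_progressionGrading (hg : 0 < g) :
    (fun a => Module.finrank k (progressionGrading k r g a)) =
    (Set.range fun s : ℕ => (r + g * s : ℤ)).indicator 1 := by
  funext a
  by_cases ha : a ∈ Set.range fun s : ℕ => (r + g * s : ℤ)
  · obtain ⟨s, rfl⟩ := ha
    have hset : {t : ℕ | (r + g * t : ℤ) = r + g * s} = {s} := by
      ext t
      simp [hg.ne']
    rw [Set.indicator_of_mem (Set.mem_range_self s), progressionGrading, hset,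
      Finsupp.supported_eq_span_single, Set.image_singleton,
      finrank_span_singleton (Finsupp.single_ne_zero.2 one_ne_zero), Pi.one_apply]
  · have hset : {t : ℕ | (r + g * t : ℤ) = a} = ∅ :=
      Set.eq_empty_of_forall_notMem fun t ht => ha ⟨t, ht⟩
    rw [Set.indicator_of_notMem ha, progressionGrading, hset, Finsupp.supported_empty,
      finrank_bot]

end ProgressionGrading

section PairRep

variable {k : Type u} [Field k] {n : ℕ} {w : Fin n → ℕ} {q : Fin n → Fin n → k}
  [IsAdmissible w q] {i j : Fin n} {x y μ ν : k}

variable (w) in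
/-- The operators through which the generators act on a module with active generators `x_i` and
`x_j`. -/
def pairAct (i j : Fin n) (x y μ : k) : Fin n → Module.End k (ℕ →₀ k) :=
  Function.update (Function.update 0 j (geomShift (lcmExp w i j) μ y)) i
    (geomShift (lcmExp w j i) 1 x)

lemma pairAct_left (i j : Fin n) (x y μ : k) :
    pairAct w i j x y μ i = geomShift (lcmExp w j i) 1 x :=
  Function.update_self ..

lemma pairAct_right (hij : i ≠ j) (x y μ : k) :
    pairAct w i j x y μ j = geomShift (lcmExp w i j) μ y := by
  rw [pairAct, Function.update_of_ne hij.symm, Function.update_self]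

lemma pairAct_of_ne {l : Fin n} (hli : l ≠ i) (hlj : l ≠ j) (x y μ : k) :
    pairAct w i j x y μ l = 0 := by
  rw [pairAct, Function.update_of_ne hli, Function.update_of_ne hlj, Pi.zero_apply]

lemma pairAct_mul_pairAct (hij : i ≠ j) (μ : k)
    (h : y ^ lcmExp w j i = q i j * x ^ lcmExp w i j) (l m : Fin n) :
    pairAct w i j x y μ l * pairAct w i j x y μ m =
      q m l • (pairAct w i j x y μ m * pairAct w i j x y μ l) := by
  have hcomm := geomShift_mul_geomShift μ 1 h
  by_cases hl : l ≠ i ∧ l ≠ j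
  · rw [pairAct_of_ne hl.1 hl.2, zero_mul, mul_zero, smul_zero]
  by_cases hm : m ≠ i ∧ m ≠ j
  · rw [pairAct_of_ne hm.1 hm.2, zero_mul, mul_zero, smul_zero]
  rcases (by tauto : l = i ∨ l = j) with hl | hl <;>
    rcases (by tauto : m = i ∨ m = j) with hm | hm <;>
    simp only [hl, hm, pairAct_left, pairAct_right hij]
  · rw [IsAdmissible.param_self w (q := q), one_smul]
  · rw [hcomm, smul_smul, IsAdmissible.param_mul_param w, one_smul]
  · exact hcomm
  · rw [IsAdmissible.param_self w (q := q), one_smul]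

omit [IsAdmissible w q] in
lemma pairAct_apply_mem (hi : 0 < w i) (hj : 0 < w j) {r : ℕ} {a : ℤ} {v : ℕ →₀ k} (x y μ : k)
    (hv : v ∈ progressionGrading k r ((w i).gcd (w j)) a) (l : Fin n) :
    pairAct w i j x y μ l v ∈ progressionGrading k r ((w i).gcd (w j)) (a + w l) := by
  rcases eq_or_ne l i with rfl | hli
  · rw [pairAct_left]
    have hmem := geomShift_mem_progressionGrading hv (lcmExp w j l) 1 x
    rwa [Nat.gcd_comm (w l), gcd_mul_lcmExp hj, Nat.gcd_comm (w j)] at hmem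
  rcases eq_or_ne l j with rfl | hlj
  · rw [pairAct_right hli.symm]
    have hmem := geomShift_mem_progressionGrading hv (lcmExp w i l) μ y
    rwa [gcd_mul_lcmExp hi] at hmem
  · rw [pairAct_of_ne hli hlj, LinearMap.zero_apply]
    exact zero_mem _

/-- The module with basis `e_0, e_1, …` on which `x_i` and `x_j` act by shifts, the other generators
act as zero, and the slope at `e_0` is `ν`. -/
def pairRep (hij : i ≠ j) (r : ℕ) (hx : x ≠ 0) (h : y ^ lcmExp w j i = q i j * x ^ lcmExp w i j)
    (hμ : μ ^ lcmExp w j i * y ^ (lcmExp w i j * (lcmExp w j i).choose 2) =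
      ν * x ^ (lcmExp w j i * (lcmExp w i j).choose 2))
    (hν : ν ∈ slopeSet w q i j) : GradedRep w q where
  carrier := ℕ →₀ k
  deg := progressionGrading k r ((w i).gcd (w j))
  isInternal := isInternal_progressionGrading k r _
  act := pairAct w i j x y μ
  act_mem l _ _ hv := pairAct_apply_mem (IsAdmissible.weight_pos q i)
    (IsAdmissible.weight_pos q j) x y μ hv l
  comm := pairAct_mul_pairAct hij μ h
  hyp := by
    have hexpo (l : Fin n) : expo w l ≠ 0 := (IsAdmissible.expo_pos q l).ne'
    rw [Fintype.sum_eq_add i j hij fun l hl => by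
        rw [pairAct_of_ne hl.1 hl.2, zero_pow (hexpo l)],
      pairAct_left, pairAct_right hij, ← IsAdmissible.lcmExp_mul_edgeLength q i j,
      ← IsAdmissible.lcmExp_mul_edgeLength q j i, edgeLength_comm j i]
    exact geomShift_pow_add_geomShift_pow_eq_zero h (IsAdmissible.param_pow_edgeLength i j) hμ hν
  exists_generators := by
    classical
    refine ⟨(Finset.range (lcmExp w j i)).image fun s => Finsupp.single s 1, fun U hsub hU => ?_⟩
    refine eq_top_of_geomShift_mem
      (lcmExp_pos (IsAdmissible.weight_pos q j) (IsAdmissible.weight_pos q i)) one_ne_zero hx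
      (fun s hs => hsub (Finset.mem_coe.2 (Finset.mem_image_of_mem _ (Finset.mem_range.2 hs))))
      fun v hv => ?_
    rw [← pairAct_left i j x y μ]
    exact hU i v hv

lemma exists_shift_parameters [IsAlgClosed k] (i j : Fin n) (hν : ν ≠ 0) :
    ∃ x y μ : k, x ≠ 0 ∧ y ≠ 0 ∧ μ ≠ 0 ∧ y ^ lcmExp w j i = q i j * x ^ lcmExp w i j ∧
      μ ^ lcmExp w j i * y ^ (lcmExp w i j * (lcmExp w j i).choose 2) =
        ν * x ^ (lcmExp w j i * (lcmExp w i j).choose 2) := by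
  have hi : 0 < w i := IsAdmissible.weight_pos q i
  have hj : 0 < w j := IsAdmissible.weight_pos q j
  obtain ⟨x, hx, y, hy, h⟩ := exists_pow_eq_mul_pow (coprime_lcmExp hj hi)
    (IsAdmissible.param_ne_zero w i j : q i j ≠ 0)
  obtain ⟨μ, hμ⟩ := IsAlgClosed.exists_pow_nat_eq (ν * x ^ (lcmExp w j i * (lcmExp w i j).choose 2)
    / y ^ (lcmExp w i j * (lcmExp w j i).choose 2)) (lcmExp_pos hj hi)
  refine ⟨x, y, μ, hx, hy, ne_zero_pow (lcmExp_pos hj hi).ne' (hμ ▸ ?_), h,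
    (eq_div_iff (pow_ne_zero _ hy)).1 hμ⟩
  exact div_ne_zero (mul_ne_zero hν (pow_ne_zero _ hx)) (pow_ne_zero _ hy)

lemma ne_zero_of_mem_slopeSet (hν : ν ∈ slopeSet w q i j) : ν ≠ 0 := by
  rintro rfl
  rw [slopeSet, Set.mem_ofPred_eq, zero_pow (IsAdmissible.edgeLength_pos q i j).ne', zero_mul,
    eq_comm, neg_eq_zero] at hν
  exact one_ne_zero hν

theorem exists_isPairPoint_of_mem_slopeSet [IsAlgClosed k] (hij : i ≠ j)
    (hν : ν ∈ slopeSet w q i j) (r : ℕ) : ∃ M : GrMod k (hypGrading w q), M.IsOneCritical ∧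
      M.HasMultiplicity ((w i).gcd (w j) : ℝ)⁻¹ ∧ M.IsPairPoint i j r ν := by
  obtain ⟨x, y, μ, hx, hy, hμ, h, hslope⟩ :=
    exists_shift_parameters (w := w) (q := q) i j (ne_zero_of_mem_slopeSet hν)
  let R := pairRep hij r hx h hslope hν
  have hg : 0 < (w i).gcd (w j) := Nat.gcd_pos_of_pos_left _ (IsAdmissible.weight_pos q i)
  have hhilb : R.toGrMod.hilb = _ := finrank_progressionGrading hg
  have hi : i ∈ R.toGrMod.active := R.mem_active_iff.2 <| by
    change Function.Injective (pairAct w i j x y μ i)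
    exact pairAct_left i j x y μ ▸ geomShift_injective _ one_ne_zero hx
  have hj : j ∈ R.toGrMod.active := R.mem_active_iff.2 <| by
    change Function.Injective (pairAct w i j x y μ j)
    exact pairAct_right hij x y μ ▸ geomShift_injective _ hμ hy
  have hact : R.toGrMod.active = {i, j} := by
    refine Set.Subset.antisymm (fun l hl => ?_)
      (Set.insert_subset hi (Set.singleton_subset_iff.2 hj))
    by_contra hlij
    have hinj : Function.Injective (pairAct w i j x y μ l) := R.mem_active_iff.1 hl
    rw [pairAct_of_ne (not_or.1 hlij).1 (not_or.1 hlij).2] at hinj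
    exact one_ne_zero
      (Finsupp.single_eq_zero.1 (hinj (a₁ := Finsupp.single 0 1) (a₂ := 0) rfl))
  have he₀ : (Finsupp.single 0 1 : ℕ →₀ k) ∈ R.toGrMod.deg (r + (0 * ∑ l, w l : ℕ)) :=
    Finsupp.single_mem_supported k _ (by simp)
  have hslope' : (pairAct w i j x y μ j ^ lcmExp w j i) (Finsupp.single 0 1) =
      ν • (pairAct w i j x y μ i ^ lcmExp w i j) (Finsupp.single 0 1) := by
    rw [pairAct_left, pairAct_right hij]
    exact geomShift_pow_smul_single_zero hslope
  refine ⟨R.toGrMod, GrMod.isOneCritical_of_hilb_eq_indicator hi hj hhilb,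
    GrMod.hasMultiplicity_of_hilb_eq_indicator hg hhilb,
    GrMod.isPairPoint_of_slope hact he₀ (Finsupp.single_ne_zero.2 one_ne_zero) ?_⟩
  exact (R.gen_pow_smul j _ _).trans
    (hslope'.trans (congrArg (ν • ·) (R.gen_pow_smul i _ _).symm))

end PairRep

/-! ### Counting the points -/

section Count

variable {k : Type u} [Field k] [IsAlgClosed k] {n : ℕ} {w : Fin n → ℕ} {q : Fin n → Fin n → k}

lemma ncard_setOf_pow_eq {m : ℕ} (hm : (m : k) ≠ 0) {c : k} (hc : c ≠ 0) :
    {ν : k | ν ^ m = c}.ncard = m := by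
  classical
  have hm₀ : 0 < m := Nat.pos_of_ne_zero (by rintro rfl; exact hm Nat.cast_zero)
  have hset : {ν : k | ν ^ m = c} = ((Polynomial.nthRoots m c).toFinset : Set k) :=
    Set.ext fun ν => by
      rw [Set.mem_ofPred_eq, Finset.mem_coe, Multiset.mem_toFinset, Polynomial.mem_nthRoots hm₀]
  rw [hset, Set.ncard_coe_finset, Polynomial.nthRoots, Multiset.toFinset_card_of_nodup
      (Polynomial.nodup_roots (Polynomial.separable_X_pow_sub_C c hm hc)),
    IsAlgClosed.card_roots_eq_natDegree, Polynomial.natDegree_X_pow_sub_C]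

variable [IsAdmissible w q] {i j : Fin n}

lemma ncard_slopeSet (hij : (edgeLength w i j : k) ≠ 0) :
    (slopeSet w q i j).ncard = edgeLength w i j := by
  have hc : edgeParam w q i j ^ (edgeLength w i j).choose 2 ≠ 0 :=
    pow_ne_zero _ (pow_ne_zero _ (IsAdmissible.param_ne_zero w i j))
  have hset : slopeSet w q i j = {ν | ν ^ edgeLength w i j =
      -1 / edgeParam w q i j ^ (edgeLength w i j).choose 2} :=
    Set.ext fun ν => (eq_div_iff hc).symm
  rw [hset, ncard_setOf_pow_eq hij (div_ne_zero (neg_ne_zero.2 one_ne_zero) hc)]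

namespace GrMod.IsOneCritical

variable {M N : GrMod k (hypGrading w q)} {i' j' : Fin n} {r r' : ℕ} {ν ν' : k}

lemma exists_active_eq_pair (hfin : (ordinaryThinPoints k (hypGrading w q)).Finite)
    (hM : M.IsOneCritical) {e : ℝ} (he : M.HasMultiplicity e) (he1 : e ≤ 1) :
    ∃ i j, i < j ∧ M.active = {i, j} := by
  obtain ⟨i, hi, j, hj, hij⟩ := hM.active_nontrivial.exists_lt
  refine ⟨i, j, hij, Set.Subset.antisymm (fun l hl => ?_)
    (Set.insert_subset hi (Set.singleton_subset_iff.2 hj))⟩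
  by_contra hlij
  exact hM.infinite_ordinaryThinPoints he he1 hi hj hl hij.ne
    (Ne.symm (not_or.1 hlij).1) (Ne.symm (not_or.1 hlij).2) hfin

omit [IsAlgClosed k] in
lemma parameters_eq_of_isPairPoint (hM : M.IsOneCritical) (hN : N.IsOneCritical)
    (hMN : M.qgrClass = N.qgrClass) (hij : i < j) (hij' : i' < j')
    (hMν : M.IsPairPoint i j r ν) (hNν : N.IsPairPoint i' j' r' ν')
    (hr : r < (w i).gcd (w j)) (hr' : r' < (w i').gcd (w j')) :
    i = i' ∧ j = j' ∧ r = r' ∧ ν = ν' := by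
  have hact : ({i, j} : Set (Fin n)) = {i', j'} :=
    hMν.1.symm.trans ((hM.active_eq_of_qgrClass_eq hN hMN).trans hNν.1)
  obtain ⟨rfl, rfl⟩ : i = i' ∧ j = j' := by
    refine (Set.pair_eq_pair_iff.1 hact).resolve_right ?_
    rintro ⟨rfl, rfl⟩
    exact hij.asymm hij'
  obtain rfl := hM.residue_eq_of_isPairPoint hN hMN hMν hNν hr hr'
  exact ⟨rfl, rfl, rfl, hM.slope_eq_of_isPairPoint hN hMN hMν hNν⟩

end GrMod.IsOneCritical

end Count

end QuantumWeighted

end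

open QuantumWeighted in
theorem mainTheorem9_general {k : Type*} [Field k] [IsAlgClosed k] {n : ℕ} (w : Fin n → ℕ)
    (q : Fin n → Fin n → k) [IsAdmissible w q]
    (hchar : ∀ i j, i < j → (edgeLength w i j : k) ≠ 0)
    (hfin : (ordinaryThinPoints k (hypGrading w q)).Finite) :
    (ordinaryThinPoints k (hypGrading w q)).ncard =
      ∑ p : Fin n × Fin n with p.1 < p.2, (w p.1).gcd (w p.2) * edgeLength w p.1 p.2 := by
  let Parameters := Σ p : {p : Fin n × Fin n // p.1 < p.2},
    Fin ((w p.1.1).gcd (w p.1.2)) × slopeSet w q p.1.1 p.1.2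
  have hcard (p : {p : Fin n × Fin n // p.1 < p.2}) :
      Nat.card (slopeSet w q p.1.1 p.1.2) = edgeLength w p.1.1 p.1.2 :=
    ncard_slopeSet (hchar _ _ p.2)
  have hslopes (p : {p : Fin n × Fin n // p.1 < p.2}) : Finite (slopeSet w q p.1.1 p.1.2) :=
    Nat.finite_of_card_ne_zero ((hcard p).trans_ne (IsAdmissible.edgeLength_pos q _ _).ne')
  choose M hM hmult hpair using fun x : Parameters =>
    exists_isPairPoint_of_mem_slopeSet x.1.2.ne x.2.2.2 x.2.1
  have hbij : Set.BijOn (fun x => (M x).qgrClass) Set.univ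
      (ordinaryThinPoints k (hypGrading w q)) := by
    refine ⟨fun x _ => ⟨M x, hM x, ⟨_, hmult x, Nat.cast_inv_le_one _⟩, rfl⟩, ?_, ?_⟩
    · rintro ⟨⟨⟨i, j⟩, hij⟩, r, ν⟩ - ⟨⟨⟨i', j'⟩, hij'⟩, r', ν'⟩ - hxy
      obtain ⟨rfl, rfl, hr, hν⟩ := (hM _).parameters_eq_of_isPairPoint (hM _) hxy hij hij'
        (hpair _) (hpair _) r.2 r'.2
      exact Sigma.ext rfl (heq_of_eq (Prod.ext (Fin.ext hr) (Subtype.ext hν)))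
    · rintro _ ⟨N, hN, ⟨e, he, he1⟩, rfl⟩
      obtain ⟨i, j, hij, hact⟩ := hN.exists_active_eq_pair hfin he he1
      obtain ⟨r, hr, ν, hν, hNν⟩ := hN.exists_isPairPoint he hij.ne hact
      exact ⟨⟨⟨(i, j), hij⟩, ⟨r, hr⟩, ν, hν⟩, trivial,
        (hM _).qgrClass_eq_of_isPairPoint hN (hpair _) hNν⟩
  rw [← hbij.image_eq, hbij.injOn.ncard_image, Set.ncard_univ, Nat.card_sigma,
    Finset.sum_subtype _ (p := fun p : Fin n × Fin n => p.1 < p.2) (by simp)]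
  exact Finset.sum_congr rfl fun p _ => by rw [Nat.card_prod, Nat.card_fin, hcard]

lemma weights_eq {a b : ℕ} (ha : 0 < a) (hab : a ≤ b) (hda : a ∣ 1 + 1 + a + b)
    (hdb : b ∣ 1 + 1 + a + b) :
    (a = 1 ∧ b = 1) ∨ (a = 1 ∧ b = 3) ∨ (a = 2 ∧ b = 2) ∨ (a = 2 ∧ b = 4) ∨ (a = 4 ∧ b = 6) := by
  rcases le_or_gt b 2 with hb2 | hb2
  · interval_cases b <;> interval_cases a <;> omega
  obtain rfl : 1 + 1 + a = b :=
    Nat.eq_of_dvd_of_lt_two_mul (by omega) ((Nat.dvd_add_left dvd_rfl).1 hdb) (by omega)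
  have ha4 : a ∣ 4 := by
    refine (Nat.dvd_add_left (dvd_mul_left a 2)).1 ?_
    convert hda using 1
    ring
  have := Nat.le_of_dvd (by norm_num) ha4
  interval_cases a <;> omega

theorem mainTheorem9 {k : Type*} [Field k] [IsAlgClosed k] [CharZero k]
    (a b : ℕ) (ha : 0 < a) (hab : a ≤ b)
    (hda : a ∣ 1 + 1 + a + b) (hdb : b ∣ 1 + 1 + a + b)
    (q : Fin 4 → Fin 4 → k)
    (hq_diag : ∀ i, q i i = 1)
    (hq_inv : ∀ i j, q i j * q j i = 1)
    (hq_left : ∀ i j, q i j ^ QuantumWeighted.expo ![1, 1, a, b] i = 1)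
    (hq_right : ∀ i j, q i j ^ QuantumWeighted.expo ![1, 1, a, b] j = 1)
    (hfin : (QuantumWeighted.ordinaryThinPoints k
      (QuantumWeighted.hypGrading ![1, 1, a, b] q)).Finite) :
    (QuantumWeighted.ordinaryThinPoints k
      (QuantumWeighted.hypGrading ![1, 1, a, b] q)).ncard = 24 := by
  rcases weights_eq ha hab hda hdb with
    ⟨rfl, rfl⟩ | ⟨rfl, rfl⟩ | ⟨rfl, rfl⟩ | ⟨rfl, rfl⟩ | ⟨rfl, rfl⟩
  all_goals
    have : QuantumWeighted.IsAdmissible _ q :=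
      ⟨by decide, by decide, hq_diag, hq_inv, hq_left, hq_right⟩
    rw [mainTheorem9_general _ q (fun i j _ => Nat.cast_ne_zero.2
      (QuantumWeighted.IsAdmissible.edgeLength_pos q i j).ne') hfin]
    decide
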